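/- **Setting.** Let $T>0$ and let $E$ be a (real) countably Hilbertian nuclear space: a linear topological space whose topology is generated by an increasing sequence of Hilbertian seminorms $\|\cdot\|_0\le\|\cdot\|_1\le\cdots$ such that the completions $E_n$ of $(E,\|\cdot\|_n)$ are separable Hilbert spaces; the canonical maps $E_{n+1}\to E_n$ and $E\to E_0$ are injective, so that $E_0\supseteq E_1\supseteq\cdots\supseteq E$, and $E=\bigcap_{n\ge 0}E_n$; and for every $n$ there is $m>n$ for which the injection $E_m\hookrightarrow E_n$ is Hilbert–Schmidt, that is, $\sum_i\|e_i\|_n^2<\infty$ for every orthonormal system $(e_i)$ of $E_m$. Let $E'$ be the topological dual of $E$ with its strong topology, generated by the seminorms $p_B(f)=\sup_{\phi\in B}|f(\phi)|$ with $B\subseteq E$ bounded, and let $E_{-n}=E_n'$ with the dual norm $\|\cdot\|_{-n}$, mapped into $E'$ by restriction of functionals to $E$. For $X\in\{E',E_{-n},\mathbb R\}$ let $D_X$ be the space of all functions $x:[0,T]\to X$ that are right-continuous and have left limits; put $x(0-)=x(0)$. The graph of $x\in D_X$ is $$\gamma_x=\{(z,t)\in X\times[0,T]: z=(1-\lambda)x(t-)+\lambda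 x(t)\text{ for some }\lambda\in[0,1]\},$$ ordered by $(z_1,t_1)\le(z_2,t_2)$ if $t_1<t_2$, or if $t_1=t_2$ and $z_i=(1-\lambda_i)x(t_1-)+\lambda_i x(t_1)$ for some $0\le\lambda_1\le\lambda_2\le1$. A parametric representation of $x$ is a continuous surjection $(z_x,t_x):[0,1]\to\gamma_x$ that is non-decreasing for this order; $\Lambda_x$ is the set of these. For a continuous seminorm $p$ on $X$ put $$d_{p,\mathrm{M1}}(x,y)=\inf_{(z_x,t_x)\in\Lambda_x,\ (z_y,t_y)\in\Lambda_y}\ \sup_{s\in[0,1]}\max\{p(z_x(s)-z_y(s)),|t_x(s)-t_y(s)|\}.$$ The M1 topology on $D_{E'}$ is the topology generated by the family of pseudometrics $d_{p_B,\mathrm{M1}}$, $B\subseteq E$ bounded (their balls form a subbase); the M1 topologies on $D_{E_{-n}}$ and $D_{\mathbb R}$ are those generated by $d_{p,\mathrm{M1}}$ with $p=\|\cdot\|_{-n}$ and $p=|\cdot|$, respectively. **Proposition 2.6.** (i) For every $\phi\in E$ the projection $\pi^\phi:(D_{E'},\mathrm{M1})\to(D_{\mathbb R},\mathrm{M1})$,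 $\pi^\phi(x)=(x_t(\phi))_{t\in[0,T]}$, is continuous. (ii) For every $n\ge0$ the canonical inclusion $\iota_n:(D_{E_{-n}},\mathrm{M1})\to(D_{E'},\mathrm{M1})$ is continuous. (iii) $(D_{E'},\mathrm{M1})$ is a completely regular Hausdorff space. (iv) The Borel $\sigma$-algebra of $(D_{E'},\mathrm{M1})$ equals the Kolmogorov $\sigma$-algebra, that is, the $\sigma$-algebra generated by the projections $$x\mapsto(x_{t_1}(\phi_1),\dots,x_{t_k}(\phi_k))\in\mathbb R^k,\qquad k\in\mathbb N,\ t_1,\dots,t_k\in[0,T],\ \phi_1,\dots,\phi_k\in E.$$ -/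

import Mathlib

open Set Filter Topology

noncomputable section

namespace SkorokhodM1

universe u

/-! ### Countably Hilbertian nuclear spaces

A Hilbertian seminorm on `E` is presented by its semi-inner product
(Mathlib's `PreInnerProductSpace.Core`); the seminorm is `φ ↦ √⟪φ, φ⟫`. -/

section Hilbertian

variable {E : Type u} [AddCommGroup E] [Module ℝ E]

/-- The vector space `E`, equipped with the (semi-)inner product `c`. -/
def PreHilbert (_c : PreInnerProductSpace.Core ℝ E) : Type u := E

instance (c : PreInnerProductSpace.Core ℝ E) : SeminormedAddCommGroup (PreHilbert c) :=
  @InnerProductSpace.Core.toSeminormedAddCommGroup ℝ E _ _ _ c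

instance (c : PreInnerProductSpace.Core ℝ E) : InnerProductSpace ℝ (PreHilbert c) :=
  InnerProductSpace.ofCore c

/-- The identity map `E → (E, c)`. -/
def toPreHilbert (c : PreInnerProductSpace.Core ℝ E) : E →ₗ[ℝ] PreHilbert c where
  toFun φ := φ
  map_add' _ _ := rfl
  map_smul' _ _ := rfl

/-- The Hilbertian seminorm of `c`. -/
def hilbertSeminorm (c : PreInnerProductSpace.Core ℝ E) : Seminorm ℝ E :=
  (normSeminorm ℝ (PreHilbert c)).comp (toPreHilbert c)

theorem hilbertSeminorm_apply (c : PreInnerProductSpace.Core ℝ E) (φ : E) :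
    hilbertSeminorm c φ = √(c.inner φ φ) := rfl

/-- The Hilbert space obtained by completing `(E, c)`. -/
abbrev Hilbert (c : PreInnerProductSpace.Core ℝ E) : Type u :=
  UniformSpace.Completion (PreHilbert c)

/-- The canonical map from `E` to its completion with respect to `c`. -/
def toHilbert (c : PreInnerProductSpace.Core ℝ E) (φ : E) : Hilbert c :=
  ((toPreHilbert c φ : PreHilbert c) : UniformSpace.Completion (PreHilbert c))

/-- The canonical map between two completions of `E`: the continuous extension of the identity
of `E`. It is only used when the seminorm of `c` dominates the seminorm of `d`. -/
def hilbertMap (c d : PreInnerProductSpace.Core ℝ E) : Hilbert c → Hilbert d :=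
  UniformSpace.Completion.map (fun φ : PreHilbert c => (φ : PreHilbert d))

/-- `E` is a countably Hilbertian nuclear space, with respect to the sequence of Hilbertian
seminorms `‖·‖_n` given by the semi-inner products `c n`.  Write `E_n = Hilbert (c n)`. -/
structure IsCHNS [TopologicalSpace E] (c : ℕ → PreInnerProductSpace.Core ℝ E) : Prop where
  /-- `‖·‖_0 ≤ ‖·‖_1 ≤ ‖·‖_2 ≤ ⋯`. -/
  mono : Monotone fun n => hilbertSeminorm (c n)
  /-- The seminorms generate the topology of `E`. -/
  withSeminorms : WithSeminorms fun n => hilbertSeminorm (c n)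
  /-- Every `E_n` is separable. -/
  separable : ∀ n, TopologicalSpace.SeparableSpace (Hilbert (c n))
  /-- `E_0 ⊇ E_1 ⊇ E_2 ⊇ ⋯`: the canonical maps `E_{n+1} → E_n` are injections. -/
  nested : ∀ n, Function.Injective (hilbertMap (c (n + 1)) (c n))
  /-- `E` is a subset of `E_0`. -/
  injective : Function.Injective (toHilbert (c 0))
  /-- `E = ⋂ n, E_n`, as subsets of `E_0`. -/
  eq_iInter : range (toHilbert (c 0)) = ⋂ n, range (hilbertMap (c n) (c 0))
  /-- For every `n` there is `m > n` for which the injection of `E_m` into `E_n` is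
  Hilbert--Schmidt. -/
  hilbertSchmidt : ∀ n, ∃ m > n, ∀ s : Set (Hilbert (c m)),
    Orthonormal ℝ (fun e : s => (e : Hilbert (c m))) →
      Summable fun e : s => ‖hilbertMap (c m) (c n) e‖ ^ 2

/-- The canonical map `E → E_n` as a continuous linear map. -/
def IsCHNS.toHilbertL [TopologicalSpace E] {c : ℕ → PreInnerProductSpace.Core ℝ E}
    (h : IsCHNS c) (n : ℕ) : E →L[ℝ] Hilbert (c n) where
  toFun := toHilbert (c n)
  map_add' φ ψ := by simp [toHilbert, UniformSpace.Completion.coe_add]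
  map_smul' a φ := by simp [toHilbert, UniformSpace.Completion.coe_smul]
  cont := (UniformSpace.Completion.continuous_coe (PreHilbert (c n))).comp
    (WithSeminorms.continuous_normedSpace_rng (PreHilbert (c n)) h.withSeminorms (toPreHilbert (c n))
      ⟨{n}, 1, by simp [hilbertSeminorm]⟩)

/-- The canonical map `E_{-n} = E_n' → E'`, which restricts a functional to `E`.  Both duals
carry their strong topology; on `E_n'` this is the topology of the dual norm. -/
def IsCHNS.dualIncl [TopologicalSpace E] {c : ℕ → PreInnerProductSpace.Core ℝ E}
    (h : IsCHNS c) (n : ℕ) : StrongDual ℝ (Hilbert (c n)) →L[ℝ] StrongDual ℝ E :=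
  ContinuousLinearMap.precomp ℝ (h.toHilbertL n)

end Hilbertian

/-! ### Càdlàg paths and the M1 topology -/

/-- The space `D_X` of functions `[0,T] → X` that are right-continuous with left limits. -/
structure Cadlag (T : ℝ) (X : Type u) [TopologicalSpace X] where
  toFun : Icc (0 : ℝ) T → X
  right_continuous : ∀ t, ContinuousWithinAt toFun (Ici t) t
  left_limit : ∀ t, ∃ l, Tendsto toFun (𝓝[<] t) (𝓝 l)

namespace Cadlag

variable {T : ℝ}

instance {X : Type u} [TopologicalSpace X] : CoeFun (Cadlag T X) fun _ => Icc (0 : ℝ) T → X :=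
  ⟨Cadlag.toFun⟩

/-- Composition of a càdlàg path with a continuous map. -/
def map {X Y : Type*} [TopologicalSpace X] [TopologicalSpace Y] (f : X → Y) (hf : Continuous f)
    (x : Cadlag T X) : Cadlag T Y where
  toFun t := f (x t)
  right_continuous t := hf.continuousAt.comp_continuousWithinAt (x.right_continuous t)
  left_limit t := (x.left_limit t).imp' f fun l hl => (hf.tendsto l).comp hl

variable {X : Type u} [AddCommGroup X] [Module ℝ X] [TopologicalSpace X]

/-- The left limit `x(t-)`, with `x(0-) = x(0)`. -/
def left (x : Cadlag T X) (t : Icc (0 : ℝ) T) : X := Function.leftLim x.toFun t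

/-- The graph `γ_x`: pairs `(z, t)` with `z` in the interval `[x(t-), x(t)]`. -/
def graph (x : Cadlag T X) : Set (X × Icc (0 : ℝ) T) :=
  {p | p.1 ∈ segment ℝ (x.left p.2) (x p.2)}

end Cadlag

/-- The order of the interval `[f, g]`: `h₁` comes before `h₂`. -/
def SegmentLE {X : Type u} [AddCommGroup X] [Module ℝ X] (f g h₁ h₂ : X) : Prop :=
  ∃ a ∈ Icc (0 : ℝ) 1, ∃ b ∈ Icc (0 : ℝ) 1,
    h₁ = (1 - a) • f + a • g ∧ h₂ = (1 - b) • f + b • g ∧ a ≤ b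

namespace Cadlag

variable {T : ℝ} {X : Type u} [AddCommGroup X] [Module ℝ X] [TopologicalSpace X]

/-- The order of the graph `γ_x`. -/
def GraphLE (x : Cadlag T X) (p q : X × Icc (0 : ℝ) T) : Prop :=
  p.2 < q.2 ∨ (p.2 = q.2 ∧ SegmentLE (x.left p.2) (x p.2) p.1 q.1)

/-- `l ∈ Λ_x`: the map `l` is a parametric representation of `γ_x`, that is a continuous
non-decreasing surjection `[0,1] → γ_x`. -/
structure IsParamRep (x : Cadlag T X) (l : Icc (0 : ℝ) 1 → X × Icc (0 : ℝ) T) : Prop where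
  continuous : Continuous l
  range_eq : range l = x.graph
  mono : ∀ s s', s ≤ s' → x.GraphLE (l s) (l s')

/-- The distance of two parametric representations, measured with a seminorm `p` on `X`. -/
def paramDist (p : X → ℝ) (l l' : Icc (0 : ℝ) 1 → X × Icc (0 : ℝ) T) : ℝ :=
  ⨆ s, max (p ((l s).1 - (l' s).1)) |((l s).2 : ℝ) - ((l' s).2 : ℝ)|

/-- The M1 pseudometric on `D_X` associated with a continuous seminorm `p` on `X`. -/
def m1Dist (p : X → ℝ) (x y : Cadlag T X) : ℝ :=
  sInf {r | ∃ l l', x.IsParamRep l ∧ y.IsParamRep l' ∧ r = paramDist p l l'}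

/-- The topology on `D_X` generated by the M1 pseudometrics of a family `P` of seminorms: the
balls of these pseudometrics form a subbase. -/
@[reducible] def m1Of (T : ℝ) (P : Set (X → ℝ)) : TopologicalSpace (Cadlag T X) :=
  TopologicalSpace.generateFrom
    {U | ∃ p ∈ P, ∃ x₀ : Cadlag T X, ∃ ε > 0, U = {x | m1Dist p x x₀ < ε}}

/-- The M1 topology on `D_X` for a normed space `X`. -/
@[reducible] def m1 (T : ℝ) (X : Type*) [NormedAddCommGroup X] [NormedSpace ℝ X] :
    TopologicalSpace (Cadlag T X) :=
  m1Of T {fun z : X => ‖z‖}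

end Cadlag

section Dual

variable {E : Type u} [AddCommGroup E] [Module ℝ E] [TopologicalSpace E]

/-- The seminorm `p_B(f) = sup_{φ ∈ B} |f(φ)|` on `E'`. -/
def dualSeminorm (B : Set E) (f : StrongDual ℝ E) : ℝ := sSup ((fun φ => |f φ|) '' B)

variable (E) in
/-- The M1 topology on `D_{E'}`, generated by the pseudometrics of the seminorms `p_B`, where `B`
runs over the bounded subsets of `E`. -/
@[reducible] def dualM1 (T : ℝ) : TopologicalSpace (Cadlag T (StrongDual ℝ E)) :=
  Cadlag.m1Of T {p | ∃ B : Set E, Bornology.IsVonNBounded ℝ B ∧ p = dualSeminorm B}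

/-- The projection `π^φ : D_{E'} → D_ℝ`, `x ↦ (x_t(φ))_t`. -/
def evalPath [ContinuousSMul ℝ E] {T : ℝ} (φ : E) (x : Cadlag T (StrongDual ℝ E)) : Cadlag T ℝ :=
  x.map (fun f => f φ) (continuous_eval_const φ)

/-- The inclusion `ι_n : D_{E_{-n}} → D_{E'}`. -/
def inclPath {c : ℕ → PreInnerProductSpace.Core ℝ E} (h : IsCHNS c) {T : ℝ} (n : ℕ)
    (x : Cadlag T (StrongDual ℝ (Hilbert (c n)))) : Cadlag T (StrongDual ℝ E) :=
  x.map (h.dualIncl n) (h.dualIncl n).continuous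

variable (E) in
/-- The Kolmogorov σ-algebra on `D_{E'}`, generated by the finite-dimensional projections
`x ↦ (x_{t_1}(φ_1), …, x_{t_k}(φ_k))`. -/
@[reducible] def kolmogorov (T : ℝ) : MeasurableSpace (Cadlag T (StrongDual ℝ E)) :=
  ⨆ (k : ℕ) (t : Fin k → Icc (0 : ℝ) T) (φ : Fin k → E),
    MeasurableSpace.comap (fun (x : Cadlag T (StrongDual ℝ E)) (i : Fin k) => x (t i) (φ i))
      MeasurableSpace.pi

end Dual

end SkorokhodM1

end

noncomputable section

set_option linter.unusedSectionVars false

namespace SkorokhodM1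

universe u

namespace Cadlag

variable {T : ℝ}

/-! ### Left limits and jumps of càdlàg paths -/

section Left

variable {X : Type u} [AddCommGroup X] [Module ℝ X] [TopologicalSpace X]

/-! The M1 topology is the infimum of topologies attached to single seminorms, so everything starts
from `m1Dist` being a pseudometric. The obstacle is the triangle inequality, where the middle path
carries two unrelated parametric representations. A path with countably many jumps has a canonical
injective representation (`isParamRep_rep`, built on `exists_split_unnormalized`). Every other
representation is a monotone reparametrization of it (`IsParamRep.exists_eq_rep_comp`), and such
reparametrizations can be made close to the identity by composing with increasing bijections
(`exists_orderIso_near`). An infimum of pseudometrizable topologies is completely regular, and the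
seminorms of singletons separate paths. Continuous linear maps carry representations to
representations, which makes projections and inclusions continuous (`continuous_map_m1Of`).

For the σ-algebras, M1 convergence controls a path at continuity points of the limit, so evaluations
on real paths are Borel (`measurable_apply_m1_real`). Composed with the continuous projections, they
show that Kolmogorov sets are Borel.

Conversely, a gliding-hump argument puts each path in one ball of some `E_{-n}`
(`IsCHNS.exists_forall_mem_dualBall`). A Hilbert–Schmidt injection turns weak convergence in that
ball into norm convergence in `E_{-m}`, so the path lifts to `D_{E_{-m}}`
(`IsCHNS.exists_inclPath_eq`). There the M1 topology comes from one pseudometric and discretizations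
converge (`eventually_m1Dist_discretize_le`), so a map with measurable evaluations is Borel
measurable (`Cadlag.measurable_m1_of_apply`). The lift is therefore measurable, and an open set of
`D_{E'}` meets each of countably many Kolmogorov pieces in a Kolmogorov set. -/

theorem tendsto_left (x : Cadlag T X) (t : Icc (0 : ℝ) T) :
    Tendsto x (𝓝[<] t) (𝓝 (x.left t)) := by
  rcases eq_or_neBot (𝓝[<] t) with h | h
  · simp [h]
  · have := x.left_limit t
    -- `Function.leftLim` is phrased with the order topology, which has to be identified with the
    -- subtype topology.
    have e : (instTopologicalSpaceSubtype : TopologicalSpace (Icc (0 : ℝ) T)) =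
      Preorder.topology (Icc (0 : ℝ) T) := OrderTopology.topology_eq_generate_intervals
    rw [left, Function.leftLim, ← e, if_neg (not_or.2 ⟨h.ne, not_not.2 this⟩)]
    exact tendsto_nhds_limUnder this

theorem left_eq_of_eq_bot (x : Cadlag T X) {t : Icc (0 : ℝ) T} (h : 𝓝[<] t = ⊥) :
    x.left t = x t :=
  leftLim_eq_of_eq_bot _ h

theorem left_eq_of_tendsto [T2Space X] (x : Cadlag T X) {t : Icc (0 : ℝ) T} [(𝓝[<] t).NeBot]
    {l : X} (h : Tendsto x (𝓝[<] t) (𝓝 l)) : x.left t = l :=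
  leftLim_eq_of_tendsto h

theorem tendsto_right (x : Cadlag T X) (t : Icc (0 : ℝ) T) :
    Tendsto x (𝓝[>] t) (𝓝 (x t)) :=
  (x.right_continuous t).mono_left (nhdsWithin_mono _ Ioi_subset_Ici_self)

theorem map_left {Y : Type*} [AddCommGroup Y] [Module ℝ Y] [TopologicalSpace Y] [T2Space Y]
    (x : Cadlag T X) (f : X → Y) (hf : Continuous f) (t : Icc (0 : ℝ) T) :
    (x.map f hf).left t = f (x.left t) := by
  rcases eq_or_neBot (𝓝[<] t) with h | h
  · rw [left_eq_of_eq_bot _ h, left_eq_of_eq_bot _ h]; rfl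
  · exact left_eq_of_tendsto _ ((hf.tendsto _).comp (x.tendsto_left t))

/-- If a path converges along an open set of times, then so do the segments of its graph. -/
theorem eventually_segment_subset [IsTopologicalAddGroup X] [ContinuousSMul ℝ X]
    [LocallyConvexSpace ℝ X] (x : Cadlag T X)
    {s : Set (Icc (0 : ℝ) T)} (hs : IsOpen s) {t : Icc (0 : ℝ) T} {l : X}
    (h : Tendsto x (𝓝[s] t) (𝓝 l)) {U : Set X} (hU : U ∈ 𝓝 l) :
    ∀ᶠ v in 𝓝[s] t, segment ℝ (x.left v) (x v) ⊆ U := by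
  -- Left limits only land in the closure of `W`. Hence a closed neighbourhood is chosen first and a
  -- convex one inside it.
  obtain ⟨C, ⟨hC, hCc⟩, hCU⟩ := (closed_nhds_basis l).mem_iff.1 hU
  obtain ⟨W, ⟨hW, hWc⟩, hWC⟩ := (LocallyConvexSpace.convex_basis (𝕜 := ℝ) l).mem_iff.1 hC
  have hV : closure W ⊆ U := (closure_minimal hWC hCc).trans hCU
  have h1 : ∀ᶠ v in 𝓝[s] t, x v ∈ W := h hW
  filter_upwards [eventually_eventually_nhdsWithin.2 h1, h1, self_mem_nhdsWithin] with v hv hv' hvs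
  rw [hs.nhdsWithin_eq hvs] at hv
  refine (hWc.closure.segment_subset ?_ (subset_closure hv')).trans hV
  rcases eq_or_neBot (𝓝[<] v) with hb | hb
  · rw [left_eq_of_eq_bot _ hb]; exact subset_closure hv'
  · exact mem_closure_of_tendsto (x.tendsto_left v) (hv.filter_mono nhdsWithin_le_nhds)

theorem continuousAt_of_left_eq (x : Cadlag T X) {t : Icc (0 : ℝ) T} (h : x.left t = x t) :
    ContinuousAt x t := by
  rw [continuousAt_iff_continuous_left'_right']
  exact ⟨by simpa [ContinuousWithinAt, h] using x.tendsto_left t, x.tendsto_right t⟩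

/-- The set of jump times. -/
def jumps (x : Cadlag T X) : Set (Icc (0 : ℝ) T) := {t | x.left t ≠ x t}

theorem not_mem_jumps {x : Cadlag T X} {t : Icc (0 : ℝ) T} : t ∉ x.jumps ↔ x.left t = x t := by
  simp [jumps]

end Left

/-- Just before any time the path stays close to its left limit, so jumps above a fixed size do not
accumulate from the left. A set of points isolated on the left is countable. -/
theorem countable_jumps_real (x : Cadlag T ℝ) : x.jumps.Countable := by
  have key : ∀ n : ℕ, {t | 1 / ((n : ℝ) + 1) < |x.left t - x t|}.Countable := by
    intro n
    set ε := 1 / ((n : ℝ) + 1) with hε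
    have hε0 : 0 < ε := by positivity
    refine (countable_setOfPred_isolated_left_within (s := {t | ε < |x.left t - x t|})).mono ?_
    intro t ht
    refine ⟨ht, ?_⟩
    rw [inter_comm, nhdsWithin_inter', inf_principal_eq_bot]
    filter_upwards [x.eventually_segment_subset isOpen_Iio (x.tendsto_left t)
      (Metric.ball_mem_nhds _ (half_pos hε0))] with v h1
    have h2 := h1 (left_mem_segment ..)
    have h3 := h1 (right_mem_segment ..)
    have : dist (x.left v) (x v) < ε := by
      have := dist_triangle_right (x.left v) (x v) (x.left t)
      rw [Metric.mem_ball] at h2 h3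
      linarith
    rw [Real.dist_eq] at this
    exact not_lt.2 this.le
  refine (countable_iUnion key).mono fun t ht => ?_
  have : 0 < |x.left t - x t| := abs_pos.2 (sub_ne_zero.2 ht)
  obtain ⟨n, hn⟩ := exists_nat_one_div_lt this
  exact mem_iUnion.2 ⟨n, hn⟩

/-- Paths with values in `X` have countably many jumps if countably many continuous functionals
separate the points of `X`. -/
theorem countable_jumps_of_separating {X : Type u} [AddCommGroup X] [Module ℝ X]
    [TopologicalSpace X] {ι : Type*} [Countable ι] (D : ι → X → ℝ) (hD : ∀ n, Continuous (D n))
    (hsep : ∀ y z, (∀ n, D n y = D n z) → y = z) (x : Cadlag T X) : x.jumps.Countable := by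
  refine (countable_iUnion fun n => countable_jumps_real (x.map (D n) (hD n))).mono ?_
  intro t ht
  by_contra hc
  refine ht (hsep _ _ fun n => ?_)
  have : t ∉ (x.map (D n) (hD n)).jumps := fun h => hc (mem_iUnion.2 ⟨n, h⟩)
  rw [not_mem_jumps, map_left] at this
  exact this

theorem dense_compl_of_countable (hT : 0 < T) {J : Set (Icc (0 : ℝ) T)} (hJ : J.Countable) :
    Dense Jᶜ := by
  have : Nontrivial (Icc (0 : ℝ) T) := nontrivial_coe_sort.2 (⟨0, left_mem_Icc.2 hT.le, T, right_mem_Icc.2 hT.le, hT.ne⟩)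
  rw [dense_iff_inter_open]
  intro U hU hne
  obtain ⟨a, b, hab, h⟩ := hU.exists_Ioo_subset hne
  have hd := (hJ.image (Subtype.val : Icc (0 : ℝ) T → ℝ)).dense_compl ℝ
  obtain ⟨r, hr, hrJ⟩ := dense_iff_inter_open.1 hd _ (isOpen_Ioo (a := (a : ℝ)) (b := b))
    (nonempty_Ioo.2 hab)
  exact ⟨⟨r, a.2.1.trans hr.1.le, hr.2.le.trans b.2.2⟩, h hr, fun h => hrJ ⟨_, h, rfl⟩⟩

theorem frequently_nhdsGT_of_dense {Q : Set (Icc (0 : ℝ) T)} (hQ : Dense Q)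
    {t t' : Icc (0 : ℝ) T} (h : t < t') : ∃ᶠ v in 𝓝[>] t, v ∈ Q := by
  rw [Filter.frequently_iff]
  intro U hU
  obtain ⟨v, hv, hvU⟩ := (mem_nhdsGT_iff_exists_Ioo_subset' h).1 hU
  obtain ⟨r, hr, hrQ⟩ := dense_iff_inter_open.1 hQ _ isOpen_Ioo (nonempty_Ioo.2 hv)
  exact ⟨r, hvU hr, hrQ⟩

end Cadlag

/-! ### Splitting the unit interval along a countable set of times -/

/-- Disjoint compact intervals `[lo t, hi t]`, increasing in `t`, that cover `[0,1]`; the interval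
of `t` is non-degenerate exactly for `t ∈ J`. -/
structure TimeSplit (T : ℝ) (J : Set (Icc (0 : ℝ) T)) where
  lo : Icc (0 : ℝ) T → ℝ
  hi : Icc (0 : ℝ) T → ℝ
  lo_mem : ∀ t, lo t ∈ Icc (0 : ℝ) 1
  hi_mem : ∀ t, hi t ∈ Icc (0 : ℝ) 1
  lo_le_hi : ∀ t, lo t ≤ hi t
  hi_lt_lo : ∀ t t', t < t' → hi t < lo t'
  cover : ∀ s ∈ Icc (0 : ℝ) 1, ∃ t, lo t ≤ s ∧ s ≤ hi t
  lo_lt_hi : ∀ t, lo t < hi t ↔ t ∈ J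

/-- Insert at each `j ∈ J` an interval of length `w j`, where the weights are summable: `lo t` is
`t` plus the weights before `t`, and `hi t` also counts the weight at `t`. By dominated convergence
`lo` is left-continuous and `hi` is right-continuous. -/
theorem exists_split_unnormalized {T : ℝ} (hT : 0 < T) {J : Set (Icc (0 : ℝ) T)}
    (hJ : J.Countable) : ∃ lo hi : Icc (0 : ℝ) T → ℝ,
      (∀ t, 0 ≤ lo t) ∧ (∀ t, lo t ≤ hi t) ∧ (∀ t t', t < t' → hi t < lo t') ∧
      (∀ t, lo t < hi t ↔ t ∈ J) ∧ 0 < hi ⟨T, right_mem_Icc.2 hT.le⟩ ∧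
      ∀ s, 0 ≤ s → s ≤ hi ⟨T, right_mem_Icc.2 hT.le⟩ → ∃ t, lo t ≤ s ∧ s ≤ hi t := by
  obtain ⟨w, hw, C, hwC, -⟩ := hJ.exists_pos_hasSum_le one_pos
  have hws : Summable fun j : J => w j := hwC.summable
  set f : Icc (0 : ℝ) T → J → ℝ := fun t j => if (j : Icc (0 : ℝ) T) < t then w j else 0 with hf
  set g : Icc (0 : ℝ) T → J → ℝ := fun t j => if (j : Icc (0 : ℝ) T) ≤ t then w j else 0 with hg
  have hf0 : ∀ t j, 0 ≤ f t j := fun t j => by simp only [hf]; split_ifs <;> simp [(hw _).le]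
  have hg0 : ∀ t j, 0 ≤ g t j := fun t j => by simp only [hg]; split_ifs <;> simp [(hw _).le]
  have hfw : ∀ t j, f t j ≤ w j := fun t j => by simp only [hf]; split_ifs <;> simp [(hw _).le]
  have hgw : ∀ t j, g t j ≤ w j := fun t j => by simp only [hg]; split_ifs <;> simp [(hw _).le]
  have hfs : ∀ t, Summable (f t) := fun t => hws.of_nonneg_of_le (hf0 t) (hfw t)
  have hgs : ∀ t, Summable (g t) := fun t => hws.of_nonneg_of_le (hg0 t) (hgw t)
  have hfg : ∀ t j, f t j ≤ g t j := fun t j => by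
    simp only [hf, hg]
    split_ifs with h1 h2 h2
    · exact le_rfl
    · exact absurd h1.le h2
    · exact (hw _).le
    · exact le_rfl
  have hgf : ∀ t t', t < t' → ∀ j, g t j ≤ f t' j := fun t t' h j => by
    simp only [hf, hg]
    split_ifs with h1 h2 h2
    · exact le_rfl
    · exact absurd (h1.trans_lt h) h2
    · exact (hw _).le
    · exact le_rfl
  have hFL : ∀ t : Icc (0 : ℝ) T, Tendsto (fun v : Icc (0 : ℝ) T => (v : ℝ) + ∑' j, f v j) (𝓝[<] t) (𝓝 (t + ∑' j, f t j)) := by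
    intro t
    refine (continuous_subtype_val.continuousAt.mono_left nhdsWithin_le_nhds).add
      (tendsto_tsum_of_dominated_convergence hws (fun j => ?_)
        (Eventually.of_forall fun v j => by rw [Real.norm_of_nonneg (hf0 _ _)]; exact hfw _ _))
    refine tendsto_const_nhds.congr' ?_
    by_cases hj : (j : Icc (0 : ℝ) T) < t
    · filter_upwards [nhdsWithin_le_nhds (lt_mem_nhds hj)] with v hv
      simp only [hf, hj, hv, if_true]
    · filter_upwards [self_mem_nhdsWithin] with v hv
      have hjv : ¬(j : Icc (0 : ℝ) T) < v := fun h => hj (h.trans hv)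
      simp only [hf, hj, hjv, if_false]
  have hGR : ∀ t : Icc (0 : ℝ) T, Tendsto (fun v : Icc (0 : ℝ) T => (v : ℝ) + ∑' j, g v j) (𝓝[>] t) (𝓝 (t + ∑' j, g t j)) := by
    intro t
    refine (continuous_subtype_val.continuousAt.mono_left nhdsWithin_le_nhds).add
      (tendsto_tsum_of_dominated_convergence hws (fun j => ?_)
        (Eventually.of_forall fun v j => by rw [Real.norm_of_nonneg (hg0 _ _)]; exact hgw _ _))
    refine tendsto_const_nhds.congr' ?_
    by_cases hj : (j : Icc (0 : ℝ) T) ≤ t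
    · filter_upwards [self_mem_nhdsWithin] with v hv
      simp only [hg, hj, hj.trans (le_of_lt hv), if_true]
    · filter_upwards [nhdsWithin_le_nhds (gt_mem_nhds (not_le.1 hj))] with v hv
      simp only [hg, hj, not_le.2 hv, if_false]
  have hlt : ∀ t t' : Icc (0 : ℝ) T, t < t' →
      (t : ℝ) + ∑' j, g t j < t' + ∑' j, f t' j := fun t t' h =>
    add_lt_add_of_lt_of_le h ((hgs t).tsum_le_tsum (hgf t t' h) (hfs t'))
  have hle : ∀ t : Icc (0 : ℝ) T, (t : ℝ) + ∑' j, f t j ≤ t + ∑' j, g t j := fun t =>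
    add_le_add_right ((hfs t).tsum_le_tsum (hfg t) (hgs t)) _
  refine ⟨fun t => t + ∑' j, f t j, fun t => t + ∑' j, g t j,
    fun t => add_nonneg t.2.1 (tsum_nonneg (hf0 t)), hle, hlt, fun t => ?_,
    add_pos_of_pos_of_nonneg hT (tsum_nonneg (hg0 _)), fun s hs0 hsT => ?_⟩
  · rw [add_lt_add_iff_left]
    constructor
    · intro h
      by_contra hc
      refine h.ne (tsum_congr fun j => ?_)
      have : (j : Icc (0 : ℝ) T) ≠ t := fun h => hc (h ▸ j.2)
      simp only [hf, hg, this.le_iff_lt]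
    · intro h
      refine (hfs t).tsum_lt_tsum (i := ⟨t, h⟩) (hfg t) ?_ (hgs t)
      simp [hf, hg, hw]
  -- A missed `s` would split `[0,T]` into the two open sets `s < lo t` and `hi t < s`, against
  -- connectedness.
  · by_contra! hc
    have hA : IsOpen {t : Icc (0 : ℝ) T | s < t + ∑' j, f t j} := by
      refine isOpen_iff_mem_nhds.2 fun t ht => ?_
      rw [← nhdsLT_sup_nhdsGE]
      refine mem_sup.2 ⟨hFL t (lt_mem_nhds ht), mem_of_superset self_mem_nhdsWithin fun v hv => ?_⟩
      rcases eq_or_lt_of_le (show t ≤ v from hv) with rfl | h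
      · exact ht
      · exact lt_trans ht ((hle t).trans_lt (hlt t v h))
    have hB : IsOpen {t : Icc (0 : ℝ) T | t + ∑' j, g t j < s} := by
      refine isOpen_iff_mem_nhds.2 fun t ht => ?_
      rw [← nhdsLE_sup_nhdsGT]
      refine mem_sup.2 ⟨mem_of_superset self_mem_nhdsWithin fun v hv => ?_, hGR t (gt_mem_nhds ht)⟩
      rcases eq_or_lt_of_le (show v ≤ t from hv) with rfl | h
      · exact ht
      · exact lt_trans ((hlt v t h).trans_le (hle t)) ht
    have hAB : {t : Icc (0 : ℝ) T | s < t + ∑' j, f t j}ᶜ = {t | t + ∑' j, g t j < s} := by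
      ext t
      simp only [mem_compl_iff, mem_ofPred_eq, not_lt]
      exact ⟨hc t, fun h => (hle t).trans h.le⟩
    have : PreconnectedSpace (Icc (0 : ℝ) T) := Subtype.preconnectedSpace isPreconnected_Icc
    rcases isClopen_iff.1 (⟨⟨hAB ▸ hB⟩, hA⟩ : IsClopen _) with h | h
    · have h1 : (⟨T, right_mem_Icc.2 hT.le⟩ : Icc (0 : ℝ) T) ∈
          {t : Icc (0 : ℝ) T | s < t + ∑' j, f t j}ᶜ := by rw [h, compl_empty]; exact mem_univ _
      rw [hAB] at h1
      exact absurd h1 (not_lt.2 hsT)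
    · have h1 : (⟨0, left_mem_Icc.2 hT.le⟩ : Icc (0 : ℝ) T) ∈
          {t : Icc (0 : ℝ) T | s < t + ∑' j, f t j} := by rw [h]; exact mem_univ _
      have h2 : ∑' j, f ⟨0, left_mem_Icc.2 hT.le⟩ j = 0 := by
        refine (tsum_congr fun j => ?_).trans tsum_zero
        simp only [hf]
        exact if_neg (not_lt.2 (show (0 : ℝ) ≤ _ from j.1.2.1))
      rw [mem_ofPred_eq, h2, add_zero] at h1
      exact absurd h1 (not_lt.2 hs0)

theorem nonempty_timeSplit {T : ℝ} (hT : 0 < T) {J : Set (Icc (0 : ℝ) T)} (hJ : J.Countable) :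
    Nonempty (TimeSplit T J) := by
  obtain ⟨lo, hi, h0, h1, h2, h3, h4, h5⟩ := exists_split_unnormalized hT hJ
  set S := hi ⟨T, right_mem_Icc.2 hT.le⟩ with hS
  have hhiS : ∀ t, hi t ≤ S := fun t => by
    rcases eq_or_lt_of_le (show t ≤ ⟨T, right_mem_Icc.2 hT.le⟩ from t.2.2) with h | h
    · rw [h]
    · exact (h2 _ _ h).le.trans (h1 _)
  refine ⟨⟨fun t => lo t / S, fun t => hi t / S, fun t => ⟨div_nonneg (h0 t) h4.le, ?_⟩,
    fun t => ⟨div_nonneg ((h0 t).trans (h1 t)) h4.le, ?_⟩, fun t => ?_, fun t t' h => ?_,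
    fun s hs => ?_, fun t => ?_⟩⟩
  · exact (div_le_one h4).2 ((h1 t).trans (hhiS t))
  · exact (div_le_one h4).2 (hhiS t)
  · exact div_le_div_of_nonneg_right (h1 t) h4.le
  · exact div_lt_div_of_pos_right (h2 t t' h) h4
  · obtain ⟨t, ht, ht'⟩ := h5 (s * S) (mul_nonneg hs.1 h4.le) (mul_le_of_le_one_left h4.le hs.2)
    exact ⟨t, (div_le_iff₀ h4).2 ht, (le_div_iff₀ h4).2 ht'⟩
  · rw [div_lt_div_iff_of_pos_right h4, h3]

namespace TimeSplit

variable {T : ℝ} {J : Set (Icc (0 : ℝ) T)} (S : TimeSplit T J)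

/-- The time whose interval contains `s`. -/
def time (s : Icc (0 : ℝ) 1) : Icc (0 : ℝ) T := (S.cover s s.2).choose

theorem lo_le (s : Icc (0 : ℝ) 1) : S.lo (S.time s) ≤ s := (S.cover s s.2).choose_spec.1

theorem le_hi (s : Icc (0 : ℝ) 1) : s ≤ S.hi (S.time s) := (S.cover s s.2).choose_spec.2

theorem time_eq {s : Icc (0 : ℝ) 1} {t : Icc (0 : ℝ) T} (h : S.lo t ≤ s) (h' : s ≤ S.hi t) :
    S.time s = t := by
  rcases lt_trichotomy (S.time s) t with h1 | h1 | h1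
  · exact absurd (S.hi_lt_lo _ _ h1) (not_lt.2 (h.trans (S.le_hi s)))
  · exact h1
  · exact absurd (S.hi_lt_lo _ _ h1) (not_lt.2 ((S.lo_le s).trans h'))

theorem time_monotone : Monotone S.time := by
  intro s s' h
  by_contra! hc
  have h1 := S.hi_lt_lo _ _ hc
  have h2 := S.lo_le s
  have h3 := S.le_hi s'
  have h4 : (s : ℝ) ≤ s' := h
  linarith

theorem time_lo (t : Icc (0 : ℝ) T) : S.time ⟨S.lo t, S.lo_mem t⟩ = t :=
  S.time_eq le_rfl (S.lo_le_hi t)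

theorem time_surjective : Function.Surjective S.time := fun t => ⟨_, S.time_lo t⟩

theorem continuous_time : Continuous S.time := S.time_monotone.continuous_of_surjective
  S.time_surjective

theorem lt_time {s : Icc (0 : ℝ) 1} {t : Icc (0 : ℝ) T} (h : S.hi t < s) : t < S.time s := by
  by_contra! hc
  rcases hc.eq_or_lt with h1 | h1
  · exact absurd (h1 ▸ S.le_hi s) (not_le.2 h)
  · exact absurd (S.le_hi s)
      (not_le.2 ((S.hi_lt_lo _ _ h1).trans_le ((S.lo_le_hi t).trans h.le)))

theorem time_lt {s : Icc (0 : ℝ) 1} {t : Icc (0 : ℝ) T} (h : s < S.lo t) : S.time s < t := by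
  by_contra! hc
  rcases hc.eq_or_lt with h1 | h1
  · exact absurd (h1 ▸ S.lo_le s) (not_le.2 h)
  · exact absurd (S.lo_le s)
      (not_le.2 (h.trans_le ((S.lo_le_hi t).trans (S.hi_lt_lo _ _ h1).le)))

/-- The relative position of `s` in the interval of its time. -/
def ratio (s : Icc (0 : ℝ) 1) : ℝ :=
  (s - S.lo (S.time s)) / (S.hi (S.time s) - S.lo (S.time s))

theorem ratio_mem (s : Icc (0 : ℝ) 1) : S.ratio s ∈ Icc (0 : ℝ) 1 := by
  have h1 := S.lo_le s
  have h2 := S.le_hi s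
  -- A degenerate interval gives `0 / 0 = 0`, which is still in the unit interval.
  exact ⟨div_nonneg (by linarith) (by linarith), div_le_one_of_le₀ (by linarith) (by linarith)⟩

theorem ratio_le {s s' : Icc (0 : ℝ) 1} (h : s ≤ s') (ht : S.time s = S.time s') :
    S.ratio s ≤ S.ratio s' := by
  unfold ratio
  rw [ht]
  exact div_le_div_of_nonneg_right (sub_le_sub_right (show (s : ℝ) ≤ s' from h) _) (sub_nonneg.2 (S.lo_le_hi _))

end TimeSplit

/-! ### The canonical parametric representation -/

section Rep

variable {T : ℝ} {J : Set (Icc (0 : ℝ) T)} {X : Type u} [AddCommGroup X] [Module ℝ X]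
  [TopologicalSpace X]

/-- The parametric representation of `x` that traverses the segment at time `t` linearly on the
interval of `t`. -/
def Cadlag.rep (x : Cadlag T X) (S : TimeSplit T J) (s : Icc (0 : ℝ) 1) : X × Icc (0 : ℝ) T :=
  ((1 - S.ratio s) • x.left (S.time s) + S.ratio s • x (S.time s), S.time s)

namespace Cadlag

variable (x : Cadlag T X) (S : TimeSplit T J)

theorem rep_mem_segment (s : Icc (0 : ℝ) 1) :
    (x.rep S s).1 ∈ segment ℝ (x.left (S.time s)) (x (S.time s)) :=
  ⟨1 - S.ratio s, S.ratio s, by linarith [(S.ratio_mem s).2], (S.ratio_mem s).1, by ring, rfl⟩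

theorem rep_of_left_eq {s : Icc (0 : ℝ) 1} (h : x.left (S.time s) = x (S.time s)) :
    (x.rep S s).1 = x (S.time s) := by
  simp only [rep, h, ← add_smul, sub_add_cancel, one_smul]

variable {x} in
theorem rep_of_eq_hi (hJ : x.jumps ⊆ J) {s : Icc (0 : ℝ) 1} (h : s = S.hi (S.time s)) :
    (x.rep S s).1 = x (S.time s) := by
  by_cases hs : S.time s ∈ J
  · have := (S.lo_lt_hi _).2 hs
    have : S.ratio s = 1 := by
      rw [TimeSplit.ratio, h, div_self (by linarith)]
    simp [rep, this]
  · exact x.rep_of_left_eq S (not_mem_jumps.1 fun h => hs (hJ h))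

theorem rep_of_eq_lo {s : Icc (0 : ℝ) 1} (h : s = S.lo (S.time s)) :
    (x.rep S s).1 = x.left (S.time s) := by
  have : S.ratio s = 0 := by rw [TimeSplit.ratio, ← h, sub_self, zero_div]
  simp [rep, this]

variable [IsTopologicalAddGroup X] [ContinuousSMul ℝ X]

theorem continuousOn_rep_of_time (t : Icc (0 : ℝ) T) :
    ContinuousOn (fun s => (x.rep S s).1) {s | S.time s = t} := by
  have : ContinuousOn (fun s : Icc (0 : ℝ) 1 =>
      (1 - (s - S.lo t) / (S.hi t - S.lo t)) • x.left t +
        ((s - S.lo t) / (S.hi t - S.lo t)) • x t) {s | S.time s = t} := by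
    fun_prop
  refine this.congr fun s hs => ?_
  simp only [rep, TimeSplit.ratio, show S.time s = t from hs]

variable [LocallyConvexSpace ℝ X]

variable {x} in
theorem continuous_rep (hJ : x.jumps ⊆ J) : Continuous (x.rep S) := by
  refine Continuous.prodMk (continuous_iff_continuousAt.2 fun s => ?_) S.continuous_time
  rw [continuousAt_iff_continuous_left'_right']
  constructor
  -- At the left end of its interval, smaller parameters have strictly smaller times, so the values
  -- approach the left limit. Elsewhere the time is constant just to the left and the formula is
  -- affine there. The right side is symmetric.
  · rcases (S.lo_le s).eq_or_lt with h | h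
    · intro U hU
      have hU' : U ∈ 𝓝 (x.left (S.time s)) := by
        rw [← x.rep_of_eq_lo S h.symm]; exact hU
      have ht : Tendsto S.time (𝓝[<] s) (𝓝[<] (S.time s)) :=
        tendsto_nhdsWithin_iff.2 ⟨S.continuous_time.continuousAt.mono_left nhdsWithin_le_nhds, by
          filter_upwards [self_mem_nhdsWithin] with v hv
          exact S.time_lt (h ▸ show (v : ℝ) < s from hv)⟩
      rw [mem_map]
      filter_upwards [ht.eventually
        (x.eventually_segment_subset isOpen_Iio (x.tendsto_left _) hU')] with v hv
      exact hv (x.rep_mem_segment S v)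
    · refine ((x.continuousOn_rep_of_time S (S.time s)) s rfl).mono_of_mem_nhdsWithin ?_
      filter_upwards [self_mem_nhdsWithin, nhdsWithin_le_nhds
        (continuous_subtype_val.continuousAt.eventually (lt_mem_nhds h))] with v hv hv'
      exact S.time_eq (le_of_lt hv') ((le_of_lt (show (v : ℝ) < s from hv)).trans (S.le_hi s))
  · rcases (S.le_hi s).eq_or_lt with h | h
    · intro U hU
      have hU' : U ∈ 𝓝 (x (S.time s)) := by
        rw [← rep_of_eq_hi S hJ h]; exact hU
      have ht : Tendsto S.time (𝓝[>] s) (𝓝[>] (S.time s)) :=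
        tendsto_nhdsWithin_iff.2 ⟨S.continuous_time.continuousAt.mono_left nhdsWithin_le_nhds, by
          filter_upwards [self_mem_nhdsWithin] with v hv
          exact S.lt_time (h ▸ show (s : ℝ) < v from hv)⟩
      rw [mem_map]
      filter_upwards [ht.eventually
        (x.eventually_segment_subset isOpen_Ioi (x.tendsto_right _) hU')] with v hv
      exact hv (x.rep_mem_segment S v)
    · refine ((x.continuousOn_rep_of_time S (S.time s)) s rfl).mono_of_mem_nhdsWithin ?_
      filter_upwards [self_mem_nhdsWithin, nhdsWithin_le_nhds
        (continuous_subtype_val.continuousAt.eventually (gt_mem_nhds h))] with v hv hv'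
      exact S.time_eq ((S.lo_le s).trans (le_of_lt (show (s : ℝ) < v from hv))) (le_of_lt hv')

variable {x} in
theorem isParamRep_rep (hJ : x.jumps ⊆ J) : x.IsParamRep (x.rep S) where
  continuous := continuous_rep S hJ
  range_eq := by
    refine Subset.antisymm (range_subset_iff.2 fun s => x.rep_mem_segment S s) ?_
    rintro ⟨z, t⟩ ⟨a, b, ha, hb, hab, hz⟩
    obtain rfl : a • x.left t + b • x t = z := hz
    obtain rfl : a = 1 - b := by linarith
    have h1 := S.lo_le_hi t
    have h0 : S.lo t ≤ (1 - b) * S.lo t + b * S.hi t := by nlinarith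
    have h0' : (1 - b) * S.lo t + b * S.hi t ≤ S.hi t := by nlinarith
    set s : Icc (0 : ℝ) 1 := ⟨(1 - b) * S.lo t + b * S.hi t,
      (S.lo_mem t).1.trans h0, h0'.trans (S.hi_mem t).2⟩ with hs
    have hst : S.time s = t := S.time_eq h0 h0'
    refine ⟨s, ?_⟩
    -- For `t ∉ J` the interval of `t` and the segment at `t` are both single points.
    by_cases hJt : t ∈ J
    · have h2 := (S.lo_lt_hi t).2 hJt
      have : S.ratio s = b := by
        rw [TimeSplit.ratio, hst, div_eq_iff (by linarith)]
        simp only [hs]; ring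
      simp only [rep, this, hst]
    · have h2 := not_mem_jumps.1 fun h => hJt (hJ h)
      refine Prod.ext ?_ hst
      rw [rep_of_left_eq _ _ (by rw [hst]; exact h2), hst]
      simp only [h2, ← add_smul, sub_add_cancel, one_smul]
  mono s s' h := by
    rcases (S.time_monotone h).lt_or_eq with h1 | h1
    · exact Or.inl h1
    · refine Or.inr ⟨h1, S.ratio s, S.ratio_mem s, S.ratio s', S.ratio_mem s', rfl, ?_,
        S.ratio_le h h1⟩
      simp only [rep, h1]

theorem segment_coeff_injective {f g : X} (h : f ≠ g) {a b : ℝ}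
    (he : (1 - a) • f + a • g = (1 - b) • f + b • g) : a = b := by
  have : (a - b) • (g - f) = 0 := by
    have : (a - b) • (g - f) = ((1 - a) • f + a • g) - ((1 - b) • f + b • g) := by module
    rw [this, he, sub_self]
  rcases smul_eq_zero.1 this with h1 | h1
  · linarith
  · exact absurd (sub_eq_zero.1 h1).symm h

/-- This needs splitting exactly at the jumps: an interval inserted at a continuity point would be
mapped to one point of the graph. -/
theorem rep_injective (S : TimeSplit T x.jumps) : Function.Injective (x.rep S) := by
  intro s s' h
  have ht : S.time s = S.time s' := congrArg Prod.snd h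
  have hz : (x.rep S s).1 = (x.rep S s').1 := congrArg Prod.fst h
  have h1 := S.lo_le s
  have h2 := S.le_hi s
  have h3 := S.lo_le s'
  have h4 := S.le_hi s'
  by_cases hJ : S.time s ∈ x.jumps
  · have h5 := (S.lo_lt_hi _).2 hJ
    simp only [rep, ← ht] at hz
    have := segment_coeff_injective hJ hz
    simp only [TimeSplit.ratio, ← ht] at this
    rw [div_left_inj' (by linarith)] at this
    exact Subtype.ext (by linarith)
  · have h5 : S.hi (S.time s) ≤ S.lo (S.time s) := not_lt.1 fun h => hJ ((S.lo_lt_hi _).1 h)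
    rw [← ht] at h3 h4
    exact Subtype.ext (by linarith)

variable {x} in
-- At a jump the coefficient of a point of the segment is unique; without a jump the segment is one
-- point.
theorem GraphLE.antisymm {q q' : X × Icc (0 : ℝ) T} (h : x.GraphLE q q') (h' : x.GraphLE q' q) :
    q = q' := by
  rcases h with h | ⟨ht, a, -, b, -, h1, h2, hab⟩
  · rcases h' with h' | ⟨h', -⟩
    · exact absurd h h'.asymm
    · exact absurd h' h.ne'
  rcases h' with h' | ⟨-, a', -, b', -, h1', h2', hab'⟩
  · exact absurd ht h'.ne'
  refine Prod.ext ?_ ht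
  rw [← ht] at h1' h2'
  by_cases hJ : x.left q.2 = x q.2
  · rw [h1, h2]
    simp only [hJ, ← add_smul, sub_add_cancel]
  · have e1 := segment_coeff_injective hJ (h1.symm.trans h2')
    have e2 := segment_coeff_injective hJ (h2.symm.trans h1')
    have : a = b := by linarith
    rw [h1, h2, this]

end Cadlag

end Rep

/-! ### The M1 pseudometrics -/

/-- A monotone surjection of the unit interval is uniformly close to increasing bijections. -/
theorem exists_orderIso_near {τ : Icc (0 : ℝ) 1 → Icc (0 : ℝ) 1} (hτ : Monotone τ)
    (hs : Function.Surjective τ) {δ : ℝ} (hδ : 0 < δ) (hδ1 : δ ≤ 1) :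
    ∃ α : Icc (0 : ℝ) 1 ≃o Icc (0 : ℝ) 1, ∀ s, dist (τ (α s)) s ≤ δ := by
  have hc := hτ.continuous_of_surjective hs
  -- Mixing in a little of the identity makes `τ` strictly increasing and changes it by at most `δ`.
  -- The bijection sought is the inverse of `f`.
  set f : Icc (0 : ℝ) 1 → Icc (0 : ℝ) 1 := fun s => ⟨(1 - δ) * τ s + δ * s, by
    have h1 := (τ s).2.1
    have h2 := s.2.1
    have : 0 ≤ 1 - δ := by linarith
    positivity, by
    have h1 := (τ s).2.2
    have h2 := s.2.2
    nlinarith⟩ with hf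
  have hfc : Continuous f := by fun_prop
  have hfm : StrictMono f := by
    intro s s' h
    have h1 : (τ s : ℝ) ≤ τ s' := hτ h.le
    have h2 : (s : ℝ) < s' := h
    change (1 - δ) * (τ s : ℝ) + δ * s < (1 - δ) * τ s' + δ * s'
    nlinarith
  have h0 : f ⊥ = ⊥ := by
    obtain ⟨s, hs⟩ := hs ⊥
    have : τ ⊥ = ⊥ := le_bot_iff.1 ((hτ bot_le).trans_eq hs)
    refine Subtype.ext ?_
    simp [hf, this]
  have h1 : f ⊤ = ⊤ := by
    obtain ⟨s, hs⟩ := hs ⊤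
    have : τ ⊤ = ⊤ := top_le_iff.1 (hs.symm.trans_le (hτ le_top))
    refine Subtype.ext ?_
    simp [hf, this]
  have hfs : Function.Surjective f := fun c =>
    mem_range_of_exists_le_of_exists_ge hfc ⟨⊥, h0.symm ▸ bot_le⟩ ⟨⊤, h1.symm ▸ le_top⟩
  set F := hfm.orderIsoOfSurjective f hfs
  refine ⟨F.symm, fun s => ?_⟩
  set v := F.symm s with hv
  have hFv : f v = s := F.apply_symm_apply s
  rw [← hFv, Subtype.dist_eq, Real.dist_eq]
  have : (τ v : ℝ) - f v = δ * (τ v - v) := by simp only [hf]; ring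
  rw [this, abs_mul, abs_of_pos hδ]
  refine mul_le_of_le_one_right hδ.le (abs_le.2 ⟨?_, ?_⟩) <;>
    linarith [(τ v).2.1, (τ v).2.2, v.2.1, v.2.2]

namespace Cadlag

variable {T : ℝ} {X : Type u} [AddCommGroup X] [Module ℝ X] [TopologicalSpace X]

theorem IsParamRep.comp_orderIso {x : Cadlag T X} {l : Icc (0 : ℝ) 1 → X × Icc (0 : ℝ) T}
    (h : x.IsParamRep l) (α : Icc (0 : ℝ) 1 ≃o Icc (0 : ℝ) 1) : x.IsParamRep (l ∘ α) where
  continuous := h.continuous.comp α.continuous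
  range_eq := by rw [α.surjective.range_comp, h.range_eq]
  mono s s' hs := h.mono _ _ (α.monotone hs)

theorem IsParamRep.mem_graph {x : Cadlag T X} {l : Icc (0 : ℝ) 1 → X × Icc (0 : ℝ) T}
    (h : x.IsParamRep l) (s : Icc (0 : ℝ) 1) :
    (l s).1 ∈ segment ℝ (x.left (l s).2) (x (l s).2) := by
  have : l s ∈ x.graph := h.range_eq ▸ mem_range_self s
  exact this

theorem IsParamRep.exists_eq {x : Cadlag T X} {l : Icc (0 : ℝ) 1 → X × Icc (0 : ℝ) T}
    (h : x.IsParamRep l) {z : X} {t : Icc (0 : ℝ) T} (hz : z ∈ segment ℝ (x.left t) (x t)) :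
    ∃ s, l s = (z, t) := by
  have : (z, t) ∈ range l := h.range_eq ▸ hz
  exact this

/-- A linear map sends segments onto segments and keeps their coefficients; continuity makes it
commute with left limits. -/
theorem IsParamRep.map {Y : Type*} [AddCommGroup Y] [Module ℝ Y] [TopologicalSpace Y] [T2Space Y]
    {x : Cadlag T X} {l : Icc (0 : ℝ) 1 → X × Icc (0 : ℝ) T} (h : x.IsParamRep l) (f : X →L[ℝ] Y) :
    (x.map f f.continuous).IsParamRep fun s => (f (l s).1, (l s).2) where
  continuous := (f.continuous.comp (continuous_fst.comp h.continuous)).prodMk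
    (continuous_snd.comp h.continuous)
  range_eq := by
    have hseg : ∀ t, segment ℝ ((x.map f f.continuous).left t) (x.map f f.continuous t) =
        f '' segment ℝ (x.left t) (x t) := fun t => by
      rw [map_left]
      exact (image_segment ℝ f.toLinearMap.toAffineMap _ _).symm
    refine Subset.antisymm (range_subset_iff.2 fun s => ?_) ?_
    · show _ ∈ segment ℝ _ _
      rw [hseg]
      exact mem_image_of_mem _ (h.mem_graph s)
    · rintro ⟨z, t⟩ hz
      have hz' : z ∈ segment ℝ ((x.map f f.continuous).left t) (x.map f f.continuous t) := hz
      rw [hseg] at hz'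
      obtain ⟨y, hy, rfl⟩ := hz'
      obtain ⟨s, hs⟩ := h.exists_eq hy
      exact ⟨s, by simp [hs]⟩
  mono s s' hs := by
    rcases h.mono s s' hs with h1 | ⟨h1, a, ha, b, hb, h2, h3, hab⟩
    · exact Or.inl h1
    · refine Or.inr ⟨h1, a, ha, b, hb, ?_, ?_, hab⟩
      · simp only [map_left, h2, map_add, map_smul]; rfl
      · simp only [map_left, h3, map_add, map_smul]; rfl

variable (p : Seminorm ℝ X)

theorem m1Dist_nonneg (x y : Cadlag T X) : 0 ≤ m1Dist p x y := by
  refine Real.sInf_nonneg ?_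
  rintro r ⟨l, l', -, -, rfl⟩
  exact Real.iSup_nonneg fun s => le_max_of_le_right (abs_nonneg _)

variable {p} in
theorem m1Dist_le {x y : Cadlag T X} {l l' : Icc (0 : ℝ) 1 → X × Icc (0 : ℝ) T}
    (hl : x.IsParamRep l) (hl' : y.IsParamRep l') {r : ℝ}
    (h : ∀ s, p ((l s).1 - (l' s).1) ≤ r) (h' : ∀ s, |((l s).2 : ℝ) - (l' s).2| ≤ r) :
    m1Dist p x y ≤ r := by
  have hb : BddBelow {r | ∃ l l', x.IsParamRep l ∧ y.IsParamRep l' ∧ r = paramDist p l l'} := ?_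
  · exact (csInf_le hb ⟨l, l', hl, hl', rfl⟩).trans (ciSup_le fun s => max_le (h s) (h' s))
  refine ⟨0, ?_⟩
  rintro r ⟨l, l', -, -, rfl⟩
  exact Real.iSup_nonneg fun s => le_max_of_le_right (abs_nonneg _)

theorem m1Dist_comm (x y : Cadlag T X) : m1Dist p x y = m1Dist p y x := by
  have : ∀ l l' : Icc (0 : ℝ) 1 → X × Icc (0 : ℝ) T, paramDist p l l' = paramDist p l' l :=
    fun l l' => by
      unfold paramDist
      congr 1
      ext s
      rw [map_sub_rev, abs_sub_comm]
  unfold m1Dist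
  congr 1
  ext r
  constructor <;>
  · rintro ⟨l, l', hl, hl', rfl⟩
    exact ⟨l', l, hl', hl, this _ _⟩

variable [IsTopologicalAddGroup X] [ContinuousSMul ℝ X] [LocallyConvexSpace ℝ X]

theorem exists_isParamRep (hT : 0 < T) (hX : ∀ x : Cadlag T X, x.jumps.Countable)
    (x : Cadlag T X) : ∃ l, x.IsParamRep l := by
  obtain ⟨S⟩ := nonempty_timeSplit hT (hX x)
  exact ⟨_, isParamRep_rep S Subset.rfl⟩

theorem m1Dist_self (hT : 0 < T) (hX : ∀ x : Cadlag T X, x.jumps.Countable) (x : Cadlag T X) :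
    m1Dist p x x = 0 := by
  obtain ⟨l, hl⟩ := exists_isParamRep hT hX x
  exact le_antisymm (m1Dist_le hl hl (by simp) (by simp)) (m1Dist_nonneg p x x)

variable {p} in
-- Two default values must be excluded: the infimum runs over a nonempty set because representations
-- exist, and the supremum is over a bounded set because they are continuous on a compact interval.
theorem exists_reps_of_m1Dist_lt (hT : 0 < T) (hX : ∀ x : Cadlag T X, x.jumps.Countable)
    (hp : Continuous p) {x y : Cadlag T X} {r : ℝ} (h : m1Dist p x y < r) :
    ∃ l l', x.IsParamRep l ∧ y.IsParamRep l' ∧ (∀ s, p ((l s).1 - (l' s).1) < r) ∧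
      ∀ s, |((l s).2 : ℝ) - (l' s).2| < r := by
  obtain ⟨l₀, hl₀⟩ := exists_isParamRep hT hX x
  obtain ⟨l₁, hl₁⟩ := exists_isParamRep hT hX y
  obtain ⟨_, ⟨l, l', hl, hl', rfl⟩, hr⟩ := exists_lt_of_csInf_lt (s := {r | ∃ l l',
    x.IsParamRep l ∧ y.IsParamRep l' ∧ r = paramDist p l l'}) ⟨_, l₀, l₁, hl₀, hl₁, rfl⟩ h
  have hc := hl.continuous
  have hc' := hl'.continuous
  have hcont : Continuous fun s => max (p ((l s).1 - (l' s).1)) |((l s).2 : ℝ) - (l' s).2| := by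
    fun_prop
  have hle : ∀ s, max (p ((l s).1 - (l' s).1)) |((l s).2 : ℝ) - (l' s).2| < r := fun s =>
    (le_ciSup (isCompact_range hcont).bddAbove s).trans_lt hr
  exact ⟨l, l', hl, hl', fun s => (le_max_left _ _).trans_lt (hle s),
    fun s => (le_max_right _ _).trans_lt (hle s)⟩

/-- Every parametric representation is a reparametrization of the canonical one. -/
theorem IsParamRep.exists_eq_rep_comp {x : Cadlag T X} {l : Icc (0 : ℝ) 1 → X × Icc (0 : ℝ) T}
    (hl : x.IsParamRep l) (S : TimeSplit T x.jumps) :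
    ∃ τ : Icc (0 : ℝ) 1 → Icc (0 : ℝ) 1, Monotone τ ∧ Function.Surjective τ ∧
      ∀ s, l s = x.rep S (τ s) := by
  have hS := isParamRep_rep (x := x) S Subset.rfl
  have h1 : ∀ s, ∃ v, x.rep S v = l s := fun s => by
    have : l s ∈ range (x.rep S) := hS.range_eq ▸ hl.range_eq ▸ mem_range_self s
    exact this
  choose τ hτ using h1
  refine ⟨τ, fun s s' h => ?_, fun v => ?_, fun s => (hτ s).symm⟩
  · by_contra! hc
    have h2 := hS.mono _ _ hc.le
    rw [hτ, hτ] at h2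
    have h3 := GraphLE.antisymm (hl.mono _ _ h) h2
    rw [← hτ, ← hτ] at h3
    exact hc.ne' (x.rep_injective S h3)
  · have : x.rep S v ∈ range l := hl.range_eq ▸ hS.range_eq ▸ mem_range_self v
    obtain ⟨s, hs⟩ := this
    exact ⟨s, x.rep_injective S ((hτ s).trans hs)⟩

variable {p} in
theorem m1Dist_triangle (hT : 0 < T) (hX : ∀ x : Cadlag T X, x.jumps.Countable)
    (hp : Continuous p) (x y w : Cadlag T X) :
    m1Dist p x w ≤ m1Dist p x y + m1Dist p y w := by
  refine le_of_forall_pos_le_add fun ε hε => ?_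
  obtain ⟨lx, ly, hlx, hly, h1, h1'⟩ := exists_reps_of_m1Dist_lt hT hX hp
    (show m1Dist p x y < m1Dist p x y + ε / 4 by linarith)
  obtain ⟨ly', lw, hly', hlw, h2, h2'⟩ := exists_reps_of_m1Dist_lt hT hX hp
    (show m1Dist p y w < m1Dist p y w + ε / 4 by linarith)
  obtain ⟨S⟩ := nonempty_timeSplit hT (hX y)
  have hS := (isParamRep_rep (x := y) S Subset.rfl).continuous
  have hp1 : Continuous fun s => (y.rep S s).1 := hS.fst
  have hp2 : Continuous fun s => (y.rep S s).2 := hS.snd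
  -- `F` vanishes on the diagonal, so its uniform continuity bounds the effect of a small change of
  -- parameter in the canonical representation.
  set F : Icc (0 : ℝ) 1 × Icc (0 : ℝ) 1 → ℝ := fun v => max
    (p ((y.rep S v.1).1 - (y.rep S v.2).1)) |((y.rep S v.1).2 : ℝ) - (y.rep S v.2).2| with hF
  have hFc : Continuous F :=
    (hp.comp ((hp1.comp continuous_fst).sub (hp1.comp continuous_snd))).max
      (((continuous_subtype_val.comp (hp2.comp continuous_fst)).sub
        (continuous_subtype_val.comp (hp2.comp continuous_snd))).abs)
  obtain ⟨δ, hδ, hFδ⟩ := Metric.uniformContinuous_iff.1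
    (CompactSpace.uniformContinuous_of_continuous hFc) (ε / 4) (by positivity)
  have hFδ' : ∀ v v', dist v v' < δ → p ((y.rep S v).1 - (y.rep S v').1) < ε / 4 ∧
      |((y.rep S v).2 : ℝ) - (y.rep S v').2| < ε / 4 := by
    intro v v' h
    have := hFδ (a := (v, v')) (b := (v', v')) (by simp [Prod.dist_eq, h])
    have h0 : F (v', v') = 0 := by simp [hF]
    rw [Real.dist_eq, h0, sub_zero] at this
    exact max_lt_iff.1 ((le_abs_self _).trans_lt this)
  obtain ⟨τ, hτm, hτs, hτ⟩ := hly.exists_eq_rep_comp S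
  obtain ⟨τ', hτm', hτs', hτ'⟩ := hly'.exists_eq_rep_comp S
  -- After `α` and `β`, both representations of `y` are within `ε / 4` of the canonical one; the
  -- other two quarters come from the choice of near-optimal representations.
  obtain ⟨α, hα⟩ := exists_orderIso_near hτm hτs (δ := min (δ / 2) 1) (by positivity)
    (min_le_right _ _)
  obtain ⟨β, hβ⟩ := exists_orderIso_near hτm' hτs' (δ := min (δ / 2) 1) (by positivity)
    (min_le_right _ _)
  have hδ2 : min (δ / 2) 1 < δ := (min_le_left _ _).trans_lt (by linarith)
  refine m1Dist_le (hlx.comp_orderIso α) (hlw.comp_orderIso β) (fun s => ?_) fun s => ?_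
  · have e1 := h1 (α s)
    have e2 := (hFδ' _ _ ((hα s).trans_lt hδ2)).1
    have e3 := (hFδ' _ _ ((hβ s).trans_lt hδ2)).1
    have e4 := h2 (β s)
    rw [← hτ] at e2
    rw [← hτ', map_sub_rev] at e3
    have : (lx (α s)).1 - (lw (β s)).1 = ((lx (α s)).1 - (ly (α s)).1) +
      ((ly (α s)).1 - (y.rep S s).1) + ((y.rep S s).1 - (ly' (β s)).1) +
      ((ly' (β s)).1 - (lw (β s)).1) := by abel
    simp only [Function.comp_apply]
    rw [this]
    refine ((map_add_le_add p _ _).trans (add_le_add_left ((map_add_le_add p _ _).trans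
      (add_le_add_left (map_add_le_add p _ _) _)) _)).trans ?_
    linarith
  · have e1 := h1' (α s)
    have e2 := (hFδ' _ _ ((hα s).trans_lt hδ2)).2
    have e3 := (hFδ' _ _ ((hβ s).trans_lt hδ2)).2
    have e4 := h2' (β s)
    rw [← hτ] at e2
    rw [← hτ'] at e3
    simp only [Function.comp_apply]
    rw [abs_lt] at e1 e2 e3 e4
    rw [abs_le]
    constructor <;> linarith

/-- The space `D_X` with the M1 pseudometric of a continuous seminorm. -/
@[reducible] def m1PseudoMetric (hT : 0 < T) (hX : ∀ x : Cadlag T X, x.jumps.Countable)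
    {p : Seminorm ℝ X} (hp : Continuous p) : PseudoMetricSpace (Cadlag T X) where
  dist := m1Dist p
  dist_self := m1Dist_self p hT hX
  dist_comm := m1Dist_comm p
  dist_triangle := m1Dist_triangle hT hX hp

theorem m1Of_singleton (hT : 0 < T) (hX : ∀ x : Cadlag T X, x.jumps.Countable)
    {p : Seminorm ℝ X} (hp : Continuous p) :
    m1Of T {(p : X → ℝ)} = (m1PseudoMetric hT hX hp).toUniformSpace.toTopologicalSpace := by
  let := m1PseudoMetric hT hX hp
  refine (TopologicalSpace.IsTopologicalBasis.eq_generateFrom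
    (TopologicalSpace.isTopologicalBasis_of_isOpen_of_nhds ?_ ?_)).symm
  · rintro U ⟨_, rfl, x, ε, hε, rfl⟩
    exact Metric.isOpen_ball
  · intro x U hx hU
    obtain ⟨ε, hε, h⟩ := Metric.isOpen_iff.1 hU x hx
    exact ⟨Metric.ball x ε, ⟨p, rfl, x, ε, hε, rfl⟩, Metric.mem_ball_self hε, h⟩

theorem m1Of_eq_iInf (P : Set (X → ℝ)) : m1Of T P = ⨅ p : P, m1Of T {(p : X → ℝ)} := by
  unfold m1Of
  rw [← generateFrom_iUnion]
  congr 1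
  ext U
  simp only [mem_ofPred_eq, mem_iUnion, Subtype.exists, mem_singleton_iff]
  constructor
  · rintro ⟨p, hp, h⟩
    exact ⟨p, hp, p, rfl, h⟩
  · rintro ⟨p, hp, _, rfl, h⟩
    exact ⟨_, hp, h⟩

/-- Complete regularity passes to infima of topologies, and each single seminorm gives a
pseudometrizable one. -/
theorem completelyRegularSpace_m1Of (hT : 0 < T) (hX : ∀ x : Cadlag T X, x.jumps.Countable)
    {P : Set (X → ℝ)} (hP : ∀ p ∈ P, ∃ q : Seminorm ℝ X, Continuous q ∧ p = q) :
    @CompletelyRegularSpace (Cadlag T X) (m1Of T P) := by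
  rw [m1Of_eq_iInf]
  refine completelyRegularSpace_iInf fun p => ?_
  obtain ⟨q, hq, hpq⟩ := hP p p.2
  rw [hpq, m1Of_singleton hT hX hq]
  let := m1PseudoMetric hT hX hq
  infer_instance

theorem isOpen_m1Of_ball {P : Set (X → ℝ)} {p : X → ℝ} (hp : p ∈ P) (x : Cadlag T X) {ε : ℝ}
    (hε : 0 < ε) : IsOpen[m1Of T P] {y | m1Dist p y x < ε} :=
  TopologicalSpace.isOpen_generateFrom_of_mem ⟨p, hp, x, ε, hε, rfl⟩

/-! ### Functoriality under continuous linear maps -/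

section Map

variable {Y : Type*} [AddCommGroup Y] [Module ℝ Y] [TopologicalSpace Y] [T2Space Y]

/-- The constant is at least `1` because the map does not contract the time component. -/
theorem m1Dist_map_le (hT : 0 < T) (hX : ∀ x : Cadlag T X, x.jumps.Countable)
    {p : Seminorm ℝ X} (hp : Continuous p) {q : Seminorm ℝ Y} {C : ℝ} (hC : 1 ≤ C)
    (f : X →L[ℝ] Y) (hf : ∀ z, q (f z) ≤ C * p z) (x y : Cadlag T X) :
    m1Dist q (x.map f f.continuous) (y.map f f.continuous) ≤ C * m1Dist p x y := by
  have hC0 : 0 < C := by linarith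
  rw [← div_le_iff₀' hC0]
  refine le_of_forall_gt_imp_ge_of_dense fun r hr => ?_
  obtain ⟨l, l', hl, hl', h1, h2⟩ := exists_reps_of_m1Dist_lt hT hX hp hr
  rw [div_le_iff₀' hC0]
  have hr0 : 0 < r := (m1Dist_nonneg p x y).trans_lt hr
  refine m1Dist_le (hl.map f) (hl'.map f) (fun s => ?_) fun s => (h2 s).le.trans (by nlinarith)
  rw [← map_sub]
  exact (hf _).trans (mul_le_mul_of_nonneg_left (h1 s).le hC0.le)

variable [IsTopologicalAddGroup Y] [ContinuousSMul ℝ Y] [LocallyConvexSpace ℝ Y]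

theorem continuous_map_m1Of (hT : 0 < T) (hX : ∀ x : Cadlag T X, x.jumps.Countable)
    (hY : ∀ y : Cadlag T Y, y.jumps.Countable) {P : Set (X → ℝ)} {Q : Set (Y → ℝ)} (f : X →L[ℝ] Y)
    (h : ∀ q ∈ Q, ∃ q' : Seminorm ℝ Y, Continuous q' ∧ q = q' ∧
      ∃ p : Seminorm ℝ X, Continuous p ∧ (p : X → ℝ) ∈ P ∧ ∃ C, ∀ z, q' (f z) ≤ C * p z) :
    Continuous[m1Of T P, m1Of T Q] fun x : Cadlag T X => x.map f f.continuous := by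
  let := m1Of T P
  refine continuous_generateFrom_iff.2 ?_
  rintro _ ⟨q, hq, x₀, ε, hε, rfl⟩
  obtain ⟨q, hqc, rfl, p, hp, hpP, C', hC'⟩ := h q hq
  obtain ⟨C, hC1, hC⟩ : ∃ C, 1 ≤ C ∧ ∀ z, q (f z) ≤ C * p z :=
    ⟨max 1 C', le_max_left _ _, fun z =>
      (hC' z).trans (mul_le_mul_of_nonneg_right (le_max_right _ _) (apply_nonneg p z))⟩
  refine isOpen_iff_forall_mem_open.2 fun x hx => ?_
  have hx' : m1Dist q (x.map f f.continuous) x₀ < ε := hx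
  have hr : 0 < (ε - m1Dist q (x.map f f.continuous) x₀) / C :=
    div_pos (sub_pos.2 hx') (by linarith)
  refine ⟨_, fun y hy => ?_, isOpen_m1Of_ball hpP x hr, ?_⟩
  · have hy' : m1Dist p y x < _ := hy
    rw [lt_div_iff₀' (by linarith)] at hy'
    have h1 := m1Dist_map_le hT hX hp hC1 f hC y x
    have h2 := m1Dist_triangle hT hY hqc (y.map f f.continuous) (x.map f f.continuous) x₀
    show m1Dist q (y.map f f.continuous) x₀ < ε
    linarith
  · show m1Dist p x x < _
    rwa [m1Dist_self p hT hX]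

end Map

end Cadlag

namespace Cadlag

/-! ### The M1 topology and evaluation at a time -/

section Eval

variable {T : ℝ} {X : Type u} [AddCommGroup X] [Module ℝ X] [TopologicalSpace X]

/-- The final value is the largest point of the graph. The final time needs this separate treatment,
since it may be a jump and has no later times from which right-continuity could help. -/
theorem IsParamRep.apply_top {x : Cadlag T X} {l : Icc (0 : ℝ) 1 → X × Icc (0 : ℝ) T}
    [IsTopologicalAddGroup X] [ContinuousSMul ℝ X] [LocallyConvexSpace ℝ X]
    (h : x.IsParamRep l) {e : Icc (0 : ℝ) T} (he : ∀ t, t ≤ e) : l ⊤ = (x e, e) := by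
  obtain ⟨s, hs⟩ := h.exists_eq (right_mem_segment ℝ (x.left e) (x e))
  rw [← hs]
  refine GraphLE.antisymm (x := x) ?_ (h.mono _ _ le_top)
  rw [hs]
  rcases (he (l ⊤).2).lt_or_eq with h1 | h1
  · exact Or.inl h1
  · obtain ⟨a, b, ha, hb, hab, hz⟩ := h.mem_graph ⊤
    refine Or.inr ⟨h1, b, ⟨hb, by linarith⟩, 1, by simp, ?_, ?_, by linarith⟩
    · rw [← hz, show a = 1 - b by linarith]
    · simp [h1]

variable [IsTopologicalAddGroup X] [ContinuousSMul ℝ X] [LocallyConvexSpace ℝ X]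

theorem apply_top_le_m1Dist (hT : 0 < T) (hX : ∀ x : Cadlag T X, x.jumps.Countable)
    {p : Seminorm ℝ X} (hp : Continuous p) (x y : Cadlag T X) {e : Icc (0 : ℝ) T}
    (he : ∀ t, t ≤ e) : p (x e - y e) ≤ m1Dist p x y := by
  refine le_of_forall_gt_imp_ge_of_dense fun r hr => ?_
  obtain ⟨l, l', hl, hl', h1, -⟩ := exists_reps_of_m1Dist_lt hT hX hp hr
  simpa [hl.apply_top he, hl'.apply_top he] using (h1 ⊤).le

/-- M1 convergence implies convergence at the continuity points of the limit. -/
theorem exists_m1Dist_lt_imp (hT : 0 < T) (hX : ∀ x : Cadlag T X, x.jumps.Countable)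
    {p : Seminorm ℝ X} (hp : Continuous p) (x : Cadlag T X) {v : Icc (0 : ℝ) T}
    (hv : v ∉ x.jumps) {ε : ℝ} (hε : 0 < ε) :
    ∃ η > 0, ∀ y, m1Dist p x y < η → p (x v - y v) < ε := by
  have hU : {z | p (z - x v) < ε / 2} ∈ 𝓝 (x v) := by
    have : Continuous fun z => p (z - x v) := by fun_prop
    exact this.continuousAt.eventually (gt_mem_nhds (by simpa using half_pos hε))
  have hev := x.eventually_segment_subset isOpen_univ
    (by rw [nhdsWithin_univ]; exact x.continuousAt_of_left_eq (not_mem_jumps.1 hv)) hU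
  rw [nhdsWithin_univ] at hev
  obtain ⟨δ, hδ, hball⟩ := Metric.eventually_nhds_iff.1 hev
  refine ⟨min δ (ε / 2), by positivity, fun y hy => ?_⟩
  obtain ⟨l, l', hl, hl', h1, h2⟩ := exists_reps_of_m1Dist_lt hT hX hp hy
  obtain ⟨s, hs⟩ := hl'.exists_eq (right_mem_segment ℝ (y.left v) (y v))
  have e1 := h1 s
  have e2 := h2 s
  rw [hs] at e1 e2
  have e3 : p ((l s).1 - x v) < ε / 2 :=
    hball (show dist (l s).2 v < δ from e2.trans_le (min_le_left _ _)) (hl.mem_graph s)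
  have e4 := e1.trans_le (min_le_right _ _)
  have : x v - y v = (x v - (l s).1) + ((l s).1 - y v) := by abel
  rw [this]
  refine (map_add_le_add p _ _).trans_lt ?_
  rw [map_sub_rev]
  linarith

/-- The paths agree for `p` at the continuity points of `x`. These are dense, so right-continuity
gives every time before `T`. -/
theorem seminorm_sub_eq_zero_of_m1Dist (hT : 0 < T) (hX : ∀ x : Cadlag T X, x.jumps.Countable)
    {p : Seminorm ℝ X} (hp : Continuous p) {x y : Cadlag T X} (h : m1Dist p x y = 0)
    (t : Icc (0 : ℝ) T) : p (x t - y t) = 0 := by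
  have hcont : ∀ v ∉ x.jumps, p (x v - y v) = 0 := fun v hv =>
    le_antisymm (le_of_forall_pos_le_add fun ε hε => by
      obtain ⟨η, hη, hη'⟩ := exists_m1Dist_lt_imp hT hX hp x hv hε
      simpa using (hη' y (h ▸ hη)).le) (apply_nonneg p _)
  rcases (show t ≤ ⟨T, right_mem_Icc.2 hT.le⟩ from t.2.2).eq_or_lt with h1 | h1
  · refine le_antisymm ?_ (apply_nonneg p _)
    rw [← h]
    exact apply_top_le_m1Dist hT hX hp x y fun v => h1 ▸ v.2.2
  · have hf := frequently_nhdsGT_of_dense (dense_compl_of_countable hT (hX x)) h1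
    have ht : Tendsto (fun v => p (x v - y v)) (𝓝[>] t) (𝓝 (p (x t - y t))) :=
      (hp.tendsto _).comp ((x.tendsto_right t).sub (y.tendsto_right t))
    exact tendsto_nhds_unique_of_frequently_eq ht tendsto_const_nhds
      (hf.mono fun v hv => hcont v hv)

end Eval

/-! ### Borel measurability of evaluations on real paths -/

section Real

variable {T : ℝ}

/-- A path exceeding `r` in the interval also does so at a continuity point slightly to the right,
and this persists for M1-close paths. -/
theorem isClosed_setOf_forall_Ioo_le (hT : 0 < T) (a b : Icc (0 : ℝ) T) (r : ℝ) :
    IsClosed[m1 T ℝ] {x : Cadlag T ℝ | ∀ v ∈ Ioo a b, x v ≤ r} := by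
  let _ := m1 T ℝ
  rw [← isOpen_compl_iff]
  refine isOpen_iff_forall_mem_open.2 fun y hy => ?_
  have hy' : ¬∀ v ∈ Ioo a b, y v ≤ r := hy
  push Not at hy'
  obtain ⟨v₀, hv₀, hr⟩ := hy'
  have hf := frequently_nhdsGT_of_dense
    (dense_compl_of_countable hT (countable_jumps_real y)) hv₀.2
  obtain ⟨v, hvJ, ⟨hv1, hv2⟩, hv3⟩ := (hf.and_eventually ((Filter.Eventually.and
    (self_mem_nhdsWithin (s := Ioi v₀)) (nhdsWithin_le_nhds (gt_mem_nhds hv₀.2))).and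
      ((y.tendsto_right v₀).eventually (lt_mem_nhds hr)))).exists
  have hp : Continuous (normSeminorm ℝ ℝ) := continuous_norm
  obtain ⟨η, hη, hη'⟩ := exists_m1Dist_lt_imp hT countable_jumps_real hp y hvJ (sub_pos.2 hv3)
  refine ⟨_, fun w hw => ?_, isOpen_m1Of_ball (P := {fun z : ℝ => ‖z‖}) rfl y hη, ?_⟩
  · have hw' : m1Dist (normSeminorm ℝ ℝ) w y < η := hw
    rw [m1Dist_comm] at hw'
    have h1 : |y v - w v| < y v - r := hη' w hw'
    intro hc
    have h2 : w v ≤ r := hc v ⟨hv₀.1.trans hv1, hv2⟩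
    linarith [le_abs_self (y v - w v)]
  · have : m1Dist (normSeminorm ℝ ℝ) y y = 0 := m1Dist_self _ hT countable_jumps_real y
    exact this.trans_lt hη

theorem isClosed_setOf_top_le (hT : 0 < T) {e : Icc (0 : ℝ) T} (he : ∀ t, t ≤ e) (r : ℝ) :
    IsClosed[m1 T ℝ] {x : Cadlag T ℝ | x e ≤ r} := by
  let _ := m1 T ℝ
  rw [← isOpen_compl_iff]
  refine isOpen_iff_forall_mem_open.2 fun y hy => ?_
  have hy' : r < y e := not_le.1 hy
  have hp : Continuous (normSeminorm ℝ ℝ) := continuous_norm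
  refine ⟨_, fun w hw => ?_, isOpen_m1Of_ball (P := {fun z : ℝ => ‖z‖}) rfl y (sub_pos.2 hy'), ?_⟩
  · have hw' : m1Dist (normSeminorm ℝ ℝ) w y < y e - r := hw
    have h1 : |w e - y e| ≤ _ := apply_top_le_m1Dist hT countable_jumps_real hp w y he
    intro hc
    have h2 : w e ≤ r := hc
    linarith [neg_abs_le (w e - y e)]
  · have : m1Dist (normSeminorm ℝ ℝ) y y = 0 := m1Dist_self _ hT countable_jumps_real y
    exact this.trans_lt (sub_pos.2 hy')

/-- Evaluation at a fixed time is Borel measurable for the M1 topology. -/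
theorem measurable_apply_m1_real (hT : 0 < T) (t : Icc (0 : ℝ) T) :
    @Measurable _ _ (@borel (Cadlag T ℝ) (m1 T ℝ)) _ fun x : Cadlag T ℝ => x t := by
  let _ := m1 T ℝ
  let _ : MeasurableSpace (Cadlag T ℝ) := borel _
  have : BorelSpace (Cadlag T ℝ) := ⟨rfl⟩
  rcases (show t ≤ ⟨T, right_mem_Icc.2 hT.le⟩ from t.2.2).eq_or_lt with h1 | h1
  · exact measurable_of_Iic fun r =>
      (isClosed_setOf_top_le hT (fun v => h1 ▸ v.2.2) r).measurableSet
  refine measurable_of_Iio fun a => ?_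
  obtain ⟨v, -, hv, hvt⟩ := exists_seq_strictAnti_tendsto' h1
  -- By right-continuity, `x t < a` means that `x` stays below some rational `r < a` on some
  -- interval `(t, v n)`.
  have : (fun x : Cadlag T ℝ => x t) ⁻¹' Iio a =
      ⋃ (r : ℚ) (_ : (r : ℝ) < a) (n : ℕ), {x : Cadlag T ℝ | ∀ w ∈ Ioo t (v n), x w ≤ r} := by
    ext x
    simp only [mem_preimage, mem_Iio, mem_iUnion, exists_prop]
    constructor
    · intro hx
      obtain ⟨r, hr, hra⟩ := exists_rat_btwn hx
      obtain ⟨b, hb, hbr⟩ := (mem_nhdsGT_iff_exists_Ioo_subset' h1).1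
        ((x.tendsto_right t).eventually (gt_mem_nhds hr))
      obtain ⟨n, hn⟩ := (hvt.eventually (gt_mem_nhds hb)).exists
      exact ⟨r, hra, n, fun w hw => le_of_lt (hbr ⟨hw.1, hw.2.trans hn⟩)⟩
    · rintro ⟨r, hra, n, hx⟩
      have : (𝓝[>] t).NeBot := nhdsGT_neBot_of_exists_gt ⟨_, h1⟩
      refine lt_of_le_of_lt (le_of_tendsto (x.tendsto_right t) ?_) hra
      filter_upwards [Ioo_mem_nhdsGT (hv n).1] with w hw
      exact hx w hw
  rw [this]
  exact MeasurableSet.iUnion fun r => MeasurableSet.iUnion fun _ => MeasurableSet.iUnion fun n =>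
    (isClosed_setOf_forall_Ioo_le hT t (v n) r).measurableSet

end Real

end Cadlag

/-! ### Approximation by step functions -/

theorem exists_pos_forall_le {ι : Type*} (s : Finset ι) {f : ι → ℝ} (hf : ∀ i ∈ s, 0 < f i) :
    ∃ ρ > 0, ∀ i ∈ s, ρ ≤ f i := by
  have : ∀ᶠ ρ in 𝓝[>] (0 : ℝ), 0 < ρ ∧ ∀ i ∈ s, ρ ≤ f i :=
    Filter.Eventually.and (self_mem_nhdsWithin (s := Ioi (0 : ℝ))) ((eventually_all_finset s).2 fun i hi =>
      nhdsWithin_le_nhds (eventually_le_nhds (hf i hi)))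
  exact this.exists

/-- Finitely many times, the end points among them, can be shifted slightly to the right by an
increasing bijection that is close to the identity. -/
theorem exists_orderIso_shift {T : ℝ} (F : Finset ℝ) (hF : ∀ τ ∈ F, τ ∈ Icc 0 T)
    (h0 : 0 ∈ F) (hT : T ∈ F) (c : ℝ → ℝ) {m : ℝ} (hc : ∀ τ ∈ F, c τ ∈ Icc 0 m) (hc0 : c 0 = 0)
    (hcT : c T = 0) {ρ : ℝ} (hρ : 0 < ρ) (hsep : ∀ τ ∈ F, ∀ τ' ∈ F, τ ≠ τ' → ρ ≤ |τ - τ'|)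
    (hm : F.card * m < ρ) :
    ∃ e : Icc (0 : ℝ) T ≃o Icc (0 : ℝ) T,
      (∀ t, |(e t : ℝ) - t| ≤ F.card * m) ∧ ∀ t : Icc (0 : ℝ) T, (t : ℝ) ∈ F → e t = t + c t := by
  -- Each tent vanishes at the other points of `F`. The sum has Lipschitz constant at most `F.card *
  -- m / ρ < 1`, so `f` remains strictly increasing.
  set f : ℝ → ℝ := fun t => t + ∑ τ ∈ F, c τ * max 0 (1 - |t - τ| / ρ) with hf
  have hfc : Continuous f := by fun_prop
  have hfF : ∀ τ ∈ F, f τ = τ + c τ := by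
    intro τ hτ
    simp only [hf]
    rw [Finset.sum_eq_single_of_mem τ hτ]
    · simp
    · intro τ' hτ' hne
      have : 1 ≤ |τ - τ'| / ρ := (one_le_div hρ).2 (hsep τ hτ τ' hτ' hne.symm)
      rw [max_eq_left (by linarith), mul_zero]
  have htent : ∀ t t' τ : ℝ, max 0 (1 - |t - τ| / ρ) - max 0 (1 - |t' - τ| / ρ) ≤ |t' - t| / ρ := by
    intro t t' τ
    refine (le_abs_self _).trans ?_
    rw [max_comm 0, max_comm 0]
    refine (abs_max_sub_max_le_abs _ _ _).trans ?_
    rw [show 1 - |t - τ| / ρ - (1 - |t' - τ| / ρ) = (|t' - τ| - |t - τ|) / ρ by ring, abs_div,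
      abs_of_pos hρ]
    refine div_le_div_of_nonneg_right ?_ hρ.le
    simpa using abs_abs_sub_abs_le_abs_sub (t' - τ) (t - τ)
  have hmono : StrictMono f := by
    intro t t' h
    have h1 : ∑ τ ∈ F, c τ * max 0 (1 - |t - τ| / ρ) - ∑ τ ∈ F, c τ * max 0 (1 - |t' - τ| / ρ) ≤
        F.card * (m * (|t' - t| / ρ)) := by
      rw [← Finset.sum_sub_distrib, ← nsmul_eq_mul]
      refine Finset.sum_le_card_nsmul _ _ _ fun τ hτ => ?_
      rw [← mul_sub]
      exact (mul_le_mul_of_nonneg_left (htent t t' τ) (hc τ hτ).1).trans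
        (mul_le_mul_of_nonneg_right (hc τ hτ).2 (by positivity))
    have h2 : F.card * (m * (|t' - t| / ρ)) < t' - t := by
      rw [abs_of_pos (sub_pos.2 h), ← mul_assoc, ← mul_div_assoc, div_lt_iff₀ hρ, mul_comm]
      exact mul_lt_mul_of_pos_left hm (sub_pos.2 h)
    simp only [hf]
    linarith
  have hf0 : f 0 = 0 := by rw [hfF 0 h0, hc0, add_zero]
  have hfT : f T = T := by rw [hfF T hT, hcT, add_zero]
  have hT0 : 0 ≤ T := (hF 0 h0).2
  set g : Icc (0 : ℝ) T → Icc (0 : ℝ) T := fun t => ⟨f t, hf0.symm.trans_le (hmono.monotone t.2.1),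
    (hmono.monotone t.2.2).trans_eq hfT⟩ with hg
  have hgm : StrictMono g := fun t t' h => hmono h
  have hgc : Continuous g := (hfc.comp continuous_subtype_val).subtype_mk _
  have : PreconnectedSpace (Icc (0 : ℝ) T) := Subtype.preconnectedSpace isPreconnected_Icc
  have hgs : Function.Surjective g := fun t =>
    mem_range_of_exists_le_of_exists_ge hgc
      ⟨⟨0, left_mem_Icc.2 hT0⟩, show f 0 ≤ t from hf0.trans_le t.2.1⟩
      ⟨⟨T, right_mem_Icc.2 hT0⟩, show t ≤ f T from t.2.2.trans_eq hfT.symm⟩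
  refine ⟨hgm.orderIsoOfSurjective g hgs, fun t => ?_, fun t ht => hfF t ht⟩
  change |f t - t| ≤ _
  simp only [hf, add_sub_cancel_left]
  rw [abs_of_nonneg (Finset.sum_nonneg fun τ hτ => mul_nonneg (hc τ hτ).1 (le_max_left _ _)),
    ← nsmul_eq_mul]
  refine Finset.sum_le_card_nsmul _ _ _ fun τ hτ => ?_
  refine (mul_le_of_le_one_right (hc τ hτ).1 (max_le zero_le_one ?_)).trans (hc τ hτ).2
  have : 0 ≤ |(t : ℝ) - τ| / ρ := by positivity
  linarith

namespace Cadlag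

variable {T : ℝ} {X : Type u} [AddCommGroup X] [Module ℝ X] [TopologicalSpace X]

theorem tendsto_orderIso_nhdsLT (e : Icc (0 : ℝ) T ≃o Icc (0 : ℝ) T) (t : Icc (0 : ℝ) T) :
    Tendsto e (𝓝[<] t) (𝓝[<] (e t)) :=
  tendsto_nhdsWithin_iff.2 ⟨e.continuous.continuousAt.mono_left nhdsWithin_le_nhds, by
    filter_upwards [self_mem_nhdsWithin] with v hv
    exact e.strictMono hv⟩

/-- The time change of a path. -/
def timeChange (x : Cadlag T X) (e : Icc (0 : ℝ) T ≃o Icc (0 : ℝ) T) : Cadlag T X where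
  toFun t := x (e t)
  right_continuous t := (x.right_continuous (e t)).comp e.continuous.continuousWithinAt
    fun _ hv => e.monotone hv
  left_limit t := (x.left_limit (e t)).imp fun _ hl => hl.comp (tendsto_orderIso_nhdsLT e t)

theorem timeChange_left [T2Space X] (x : Cadlag T X) (e : Icc (0 : ℝ) T ≃o Icc (0 : ℝ) T)
    (t : Icc (0 : ℝ) T) : (x.timeChange e).left t = x.left (e t) := by
  rcases eq_or_neBot (𝓝[<] (e t)) with h | h
  · have h' : 𝓝[<] t = ⊥ := by
      have := tendsto_orderIso_nhdsLT e t
      rw [h] at this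
      exact Filter.map_eq_bot_iff.1 (le_bot_iff.1 this)
    rw [left_eq_of_eq_bot _ h, left_eq_of_eq_bot _ h']
    rfl
  · have h1 := tendsto_orderIso_nhdsLT e.symm (e t)
    rw [e.symm_apply_apply] at h1
    have := h1.neBot
    exact left_eq_of_tendsto _ ((x.tendsto_left _).comp (tendsto_orderIso_nhdsLT e t))

theorem IsParamRep.of_timeChange [T2Space X] {x : Cadlag T X} {e : Icc (0 : ℝ) T ≃o Icc (0 : ℝ) T}
    {l : Icc (0 : ℝ) 1 → X × Icc (0 : ℝ) T} (h : (x.timeChange e).IsParamRep l) :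
    x.IsParamRep fun s => ((l s).1, e (l s).2) where
  continuous := h.continuous.fst.prodMk (e.continuous.comp h.continuous.snd)
  range_eq := by
    refine Subset.antisymm (range_subset_iff.2 fun s => ?_) ?_
    · have := h.mem_graph s
      rw [timeChange_left] at this
      exact this
    · rintro ⟨z, t⟩ hz
      have hz' : z ∈ segment ℝ ((x.timeChange e).left (e.symm t)) (x.timeChange e (e.symm t)) := by
        rw [timeChange_left]
        have hz' : z ∈ segment ℝ (x.left t) (x t) := hz
        simpa [timeChange] using hz'
      obtain ⟨s, hs⟩ := h.exists_eq hz'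
      exact ⟨s, by simp [hs]⟩
  mono s s' hs := by
    rcases h.mono s s' hs with h1 | ⟨h1, a, ha, b, hb, h2, h3, hab⟩
    · exact Or.inl (e.strictMono h1)
    · rw [timeChange_left] at h2 h3
      exact Or.inr ⟨congrArg e h1, a, ha, b, hb, h2, h3, hab⟩

variable [T2Space X] [IsTopologicalAddGroup X] [ContinuousSMul ℝ X] [LocallyConvexSpace ℝ X]

/-- The M1 distance is dominated by uniform distance after a change of time. -/
theorem m1Dist_le_of_timeChange (hT : 0 < T) (hX : ∀ x : Cadlag T X, x.jumps.Countable)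
    {p : Seminorm ℝ X} (hp : Continuous p) {x y : Cadlag T X} (e : Icc (0 : ℝ) T ≃o Icc (0 : ℝ) T)
    {r : ℝ} (h : ∀ t, p (x t - y (e t)) ≤ r) (h' : ∀ t, |(e t : ℝ) - t| ≤ r) :
    m1Dist p x y ≤ r := by
  -- Splitting at the jumps of both paths lets them share one parametrization. The difference is
  -- then a convex combination of differences of values and of left limits.
  obtain ⟨S⟩ := nonempty_timeSplit hT ((hX x).union (hX (y.timeChange e)))
  refine m1Dist_le (isParamRep_rep (x := x) S subset_union_left)
    (isParamRep_rep (x := y.timeChange e) S subset_union_right).of_timeChange (fun s => ?_)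
    fun s => by rw [abs_sub_comm]; exact h' (S.time s)
  have hl : ∀ t, p (x.left t - (y.timeChange e).left t) ≤ r := by
    intro t
    rcases eq_or_neBot (𝓝[<] t) with hb | hb
    · rw [left_eq_of_eq_bot _ hb, left_eq_of_eq_bot _ hb]
      exact h t
    · exact le_of_tendsto ((hp.tendsto _).comp
        ((x.tendsto_left t).sub ((y.timeChange e).tendsto_left t))) (Eventually.of_forall h)
  have h1 := S.ratio_mem s
  have : (x.rep S s).1 - ((y.timeChange e).rep S s).1 =
      (1 - S.ratio s) • (x.left (S.time s) - (y.timeChange e).left (S.time s)) +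
        S.ratio s • (x (S.time s) - y (e (S.time s))) := by
    simp only [rep, timeChange]
    module
  rw [this]
  refine (map_add_le_add p _ _).trans ?_
  rw [map_smul_eq_mul, map_smul_eq_mul, Real.norm_of_nonneg h1.1,
    Real.norm_of_nonneg (sub_nonneg.2 h1.2)]
  nlinarith [hl (S.time s), h (S.time s), h1.1, h1.2]

/-- A càdlàg path oscillates little between finitely many times. -/
theorem exists_finset_oscillation_lt (x : Cadlag T X) {p : Seminorm ℝ X} (hp : Continuous p)
    {ε : ℝ} (hε : 0 < ε) :
    ∃ F : Finset ℝ, ∀ t t' : Icc (0 : ℝ) T, (∀ τ ∈ F, τ ≤ t ↔ τ ≤ t') → p (x t - x t') < ε := by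
  suffices h : ∃ F : Finset ℝ, ∀ t ∈ (univ : Set (Icc (0 : ℝ) T)), ∀ t' : Icc (0 : ℝ) T,
      (∀ τ ∈ F, τ ≤ t ↔ τ ≤ t') → p (x t - x t') < ε from
    h.imp fun F h t t' => h t (mem_univ t) t'
  refine isCompact_univ.induction_on (p := fun s : Set (Icc (0 : ℝ) T) => ∃ F : Finset ℝ, ∀ t ∈ s,
    ∀ t' : Icc (0 : ℝ) T, (∀ τ ∈ F, τ ≤ t ↔ τ ≤ t') → p (x t - x t') < ε) ⟨∅, by simp⟩ ?_ ?_ ?_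
  · rintro s s' hs ⟨F, hF⟩
    exact ⟨F, fun t ht => hF t (hs ht)⟩
  · rintro s s' ⟨F, hF⟩ ⟨F', hF'⟩
    classical
    refine ⟨F ∪ F', ?_⟩
    rintro t (ht | ht) t' h
    · exact hF t ht t' fun τ hτ => h τ (Finset.mem_union_left _ hτ)
    · exact hF' t ht t' fun τ hτ => h τ (Finset.mem_union_right _ hτ)
  · intro v _
    have hball : ∀ l : X, {z | p (z - l) < ε / 2} ∈ 𝓝 l := fun l => by
      have : Continuous fun z => p (z - l) := by fun_prop
      exact this.continuousAt.eventually (gt_mem_nhds (by simpa using half_pos hε))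
    have hR : ∀ᶠ t in 𝓝 v, t ∈ Ici v → p (x t - x v) < ε / 2 :=
      eventually_nhdsWithin_iff.1 ((x.right_continuous v).eventually (hball _))
    have hL : ∀ᶠ t in 𝓝 v, t ∈ Iio v → p (x t - x.left v) < ε / 2 :=
      eventually_nhdsWithin_iff.1 ((x.tendsto_left v).eventually (hball _))
    obtain ⟨δ, hδ, hb⟩ := Metric.eventually_nhds_iff.1 (hR.and hL)
    -- The outer two points force `t'` to stay near `v`; the middle one forces `t` and `t'` onto the
    -- same side of `v`.
    refine ⟨Metric.ball v (δ / 2), nhdsWithin_le_nhds (Metric.ball_mem_nhds v (half_pos hδ)),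
      {(v : ℝ) - δ / 2, (v : ℝ), (v : ℝ) + δ / 2}, fun t ht t' h => ?_⟩
    have h1 := h (v - δ / 2) (by simp)
    have h2 := h v (by simp)
    have h3 := h (v + δ / 2) (by simp)
    rw [Metric.mem_ball, Subtype.dist_eq, Real.dist_eq, abs_lt] at ht
    have h4 : (v : ℝ) - δ / 2 ≤ t' := h1.1 (by linarith)
    have h5 : (t' : ℝ) < v + δ / 2 := not_le.1 fun hc => absurd (h3.2 hc) (by linarith)
    have ht1 : dist t v < δ := by
      rw [Subtype.dist_eq, Real.dist_eq, abs_lt]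
      constructor <;> linarith
    have ht2 : dist t' v < δ := by
      rw [Subtype.dist_eq, Real.dist_eq, abs_lt]
      constructor <;> linarith
    have key : ∀ l, p (x t - l) < ε / 2 → p (x t' - l) < ε / 2 → p (x t - x t') < ε := by
      intro l e1 e2
      have : x t - x t' = (x t - l) + (l - x t') := by abel
      rw [this]
      refine (map_add_le_add p _ _).trans_lt ?_
      rw [map_sub_rev p l]
      linarith
    by_cases hvt : v ≤ t
    · exact key (x v) ((hb ht1).1 hvt) ((hb ht2).1 (h2.1 hvt))
    · have hvt' : ¬v ≤ t' := fun hc => hvt (h2.2 hc)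
      exact key (x.left v) ((hb ht1).2 (not_le.1 hvt)) ((hb ht2).2 (not_le.1 hvt'))

/-- The step function with value `v i` on `[i/N, (i+1)/N)`. -/
def step (T : ℝ) {N : ℝ} (hN : 0 < N) (v : ℤ → X) : Cadlag T X where
  toFun t := v ⌊N * t⌋
  right_continuous t := by
    have h1 : Tendsto (fun w : Icc (0 : ℝ) T => N * (w : ℝ)) (𝓝[≥] t) (𝓝[≥] (N * t)) :=
      tendsto_nhdsWithin_iff.2 ⟨(Continuous.tendsto (by fun_prop) t).mono_left nhdsWithin_le_nhds,
        by filter_upwards [self_mem_nhdsWithin] with w hw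
           exact mul_le_mul_of_nonneg_left (show (t : ℝ) ≤ w from hw) hN.le⟩
    have h2 := (tendsto_floor_right_pure_floor (N * (t : ℝ))).comp h1
    exact ((tendsto_pure_pure v _).comp h2).mono_right (pure_le_nhds _)
  left_limit t := by
    have h1 : Tendsto (fun w : Icc (0 : ℝ) T => N * (w : ℝ)) (𝓝[<] t) (𝓝[<] (N * t)) :=
      tendsto_nhdsWithin_iff.2 ⟨(Continuous.tendsto (by fun_prop) t).mono_left nhdsWithin_le_nhds,
        by filter_upwards [self_mem_nhdsWithin] with w hw
           exact mul_lt_mul_of_pos_left (show (w : ℝ) < t from hw) hN⟩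
    have h2 := (tendsto_floor_left_pure_ceil_sub_one (N * (t : ℝ))).comp h1
    exact ⟨_, ((tendsto_pure_pure v _).comp h2).mono_right (pure_le_nhds _)⟩

/-- The step function with the values of `x` at the points `i/N`. -/
def discretize (hT : 0 ≤ T) {N : ℝ} (hN : 0 < N) (x : Cadlag T X) : Cadlag T X :=
  step T hN fun i => x (projIcc 0 T hT (i / N))

theorem m1Dist_step_le (hT : 0 < T) (hX : ∀ x : Cadlag T X, x.jumps.Countable)
    {p : Seminorm ℝ X} (hp : Continuous p) {N : ℝ} (hN : 0 < N) {v w : ℤ → X} {r : ℝ} (hr : 0 ≤ r)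
    (h : ∀ i ∈ Icc 0 ⌊N * T⌋, p (v i - w i) ≤ r) :
    m1Dist p (step T hN v) (step T hN w) ≤ r := by
  refine m1Dist_le_of_timeChange hT hX hp (OrderIso.refl _) (fun t => h _ ⟨?_, ?_⟩)
    (by simp [hr])
  · exact Int.floor_nonneg.2 (mul_nonneg hN.le t.2.1)
  · exact Int.floor_le_floor (mul_le_mul_of_nonneg_left t.2.2 hN.le)

/-- Plain discretization misplaces large jumps by up to one grid step. A small time change moves the
finitely many critical times onto the grid, after which the oscillation bound applies. -/
theorem eventually_m1Dist_discretize_le (hT : 0 < T) (hX : ∀ x : Cadlag T X, x.jumps.Countable)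
    {p : Seminorm ℝ X} (hp : Continuous p) (x : Cadlag T X) {ε : ℝ} (hε : 0 < ε) :
    ∀ᶠ k : ℕ in atTop, m1Dist p x
      (x.discretize hT.le (N := ((k : ℝ) + 1) / T) (by positivity)) ≤ ε := by
  classical
  obtain ⟨F₀, hF₀⟩ := x.exists_finset_oscillation_lt hp hε
  set F : Finset ℝ := insert 0 (insert T (F₀.filter (· ∈ Icc 0 T))) with hF
  have hFI : ∀ τ ∈ F, τ ∈ Icc 0 T := by
    intro τ hτ
    simp only [hF, Finset.mem_insert, Finset.mem_filter] at hτ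
    rcases hτ with rfl | rfl | h
    · exact left_mem_Icc.2 hT.le
    · exact right_mem_Icc.2 hT.le
    · exact h.2
  obtain ⟨ρ, hρ, hsep⟩ := exists_pos_forall_le F.offDiag (f := fun q => |q.1 - q.2|)
    fun q hq => abs_pos.2 (sub_ne_zero.2 (Finset.mem_offDiag.1 hq).2.2)
  have hlim : Tendsto (fun k : ℕ => (F.card : ℝ) * (((k : ℝ) + 1) / T)⁻¹) atTop (𝓝 0) := by
    have : Tendsto (fun k : ℕ => (F.card : ℝ) * T * (1 / ((k : ℝ) + 1))) atTop
        (𝓝 ((F.card : ℝ) * T * 0)) := tendsto_one_div_add_atTop_nhds_zero_nat.const_mul _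
    rw [mul_zero] at this
    refine this.congr fun k => ?_
    rw [inv_div]; ring
  filter_upwards [hlim.eventually (gt_mem_nhds hρ), hlim.eventually (gt_mem_nhds hε)]
    with k hk1 hk2
  have hN : 0 < ((k : ℝ) + 1) / T := by positivity
  -- `T` is itself a grid point, so rounding up leaves it fixed.
  have hNT : ((k : ℝ) + 1) / T * T = ((k + 1 : ℤ) : ℝ) := by
    rw [div_mul_cancel₀ _ hT.ne']; push_cast; rfl
  set N := ((k : ℝ) + 1) / T with hNdef
  have hc : ∀ τ : ℝ, ⌈N * τ⌉ / N - τ ∈ Icc 0 N⁻¹ := by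
    refine fun τ => ⟨?_, ?_⟩
    · rw [sub_nonneg, le_div_iff₀' hN]
      exact Int.le_ceil _
    · rw [sub_le_iff_le_add, div_le_iff₀ hN, add_mul, inv_mul_cancel₀ hN.ne', mul_comm τ, add_comm]
      exact (Int.ceil_lt_add_one _).le
  obtain ⟨e, he1, he2⟩ := exists_orderIso_shift F hFI (by simp [hF]) (by simp [hF])
    (fun τ => ⌈N * τ⌉ / N - τ) (m := N⁻¹) (fun τ _ => hc τ) (by simp)
    (by
      show (⌈N * T⌉ : ℝ) / N - T = 0
      rw [hNT, Int.ceil_intCast, ← hNT, mul_div_cancel_left₀ _ hN.ne', sub_self]) hρ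
    (fun τ hτ τ' hτ' hne => hsep (τ, τ') (Finset.mem_offDiag.2 ⟨hτ, hτ', hne⟩)) hk1
  refine m1Dist_le_of_timeChange hT hX hp e (fun t => le_of_lt ?_)
    fun t => (he1 t).trans hk2.le
  have hg0 : (0 : ℤ) ≤ ⌊N * (e t : ℝ)⌋ := Int.floor_nonneg.2 (mul_nonneg hN.le (e t).2.1)
  have hg : (⌊N * (e t : ℝ)⌋ : ℝ) / N ∈ Icc 0 T := by
    refine ⟨div_nonneg (by exact_mod_cast hg0) hN.le, ?_⟩
    rw [div_le_iff₀' hN]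
    exact (Int.floor_le _).trans (mul_le_mul_of_nonneg_left (e t).2.2 hN.le)
  show p (x t - x (projIcc 0 T hT.le (⌊N * (e t : ℝ)⌋ / N))) < ε
  rw [projIcc_of_mem _ hg]
  refine hF₀ _ _ fun τ hτ => ?_
  show τ ≤ t ↔ τ ≤ ⌊N * (e t : ℝ)⌋ / N
  by_cases hτI : τ ∈ Icc 0 T
  · have hτF : τ ∈ F := by simp only [hF, Finset.mem_insert, Finset.mem_filter]; tauto
    -- The image of `τ` is the first grid point not before `τ`. It is at most `e t` exactly when `τ`
    -- is at most the last grid point not after `e t`.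
    have h1 : τ ≤ t ↔ e ⟨τ, hτI⟩ ≤ e t :=
      show (⟨τ, hτI⟩ : Icc (0 : ℝ) T) ≤ t ↔ _ from e.le_iff_le.symm
    rw [h1, ← Subtype.coe_le_coe, he2 ⟨τ, hτI⟩ hτF]
    show τ + (⌈N * τ⌉ / N - τ) ≤ (e t : ℝ) ↔ _
    rw [add_sub_cancel, div_le_iff₀' hN, ← Int.le_floor, Int.ceil_le, le_div_iff₀' hN]
  · rcases lt_or_ge τ 0 with h | h
    · exact iff_of_true (h.le.trans t.2.1) (h.le.trans hg.1)
    · have hτT : T < τ := not_le.1 fun hc => hτI ⟨h, hc⟩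
      exact iff_of_false (not_le.2 (t.2.2.trans_lt hτT)) (not_le.2 (hg.2.trans_lt hτT))

end Cadlag

/-! ### The strong dual of a countably Hilbertian nuclear space -/

theorem Cadlag.bddAbove_seminorm {T : ℝ} {X : Type u} [AddCommGroup X] [Module ℝ X]
    [TopologicalSpace X] (x : Cadlag T X) {p : Seminorm ℝ X} (hp : Continuous p) :
    ∃ C, ∀ t, p (x t) ≤ C := by
  suffices h : ∃ C, ∀ t ∈ (univ : Set (Icc (0 : ℝ) T)), p (x t) ≤ C from
    h.imp fun C h t => h t (mem_univ t)
  refine isCompact_univ.induction_on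
    (p := fun s : Set (Icc (0 : ℝ) T) => ∃ C, ∀ t ∈ s, p (x t) ≤ C) ⟨0, by simp⟩ ?_ ?_ ?_
  · rintro s s' hs ⟨C, hC⟩
    exact ⟨C, fun t ht => hC t (hs ht)⟩
  · rintro s s' ⟨C, hC⟩ ⟨C', hC'⟩
    refine ⟨max C C', ?_⟩
    rintro t (ht | ht)
    · exact (hC t ht).trans (le_max_left _ _)
    · exact (hC' t ht).trans (le_max_right _ _)
  · intro v _
    have hR : ∀ᶠ t in 𝓝[≥] v, p (x t) < p (x v) + 1 :=
      ((hp.tendsto _).comp (x.right_continuous v)).eventually (gt_mem_nhds (lt_add_one _))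
    have hL : ∀ᶠ t in 𝓝[<] v, p (x t) < p (x.left v) + 1 :=
      ((hp.tendsto _).comp (x.tendsto_left v)).eventually (gt_mem_nhds (lt_add_one _))
    have : ∀ᶠ t in 𝓝 v, p (x t) ≤ max (p (x v) + 1) (p (x.left v) + 1) := by
      rw [← nhdsLT_sup_nhdsGE, eventually_sup]
      exact ⟨hL.mono fun t ht => ht.le.trans (le_max_right _ _),
        hR.mono fun t ht => ht.le.trans (le_max_left _ _)⟩
    exact ⟨_, nhdsWithin_le_nhds this, _, fun t ht => ht⟩

/-! ### The seminorms of the strong dual -/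

section DualSeminorm

variable {E : Type u} [AddCommGroup E] [Module ℝ E] [TopologicalSpace E]

theorem bddAbove_abs_image {B : Set E} (hB : Bornology.IsVonNBounded ℝ B) (f : StrongDual ℝ E) :
    BddAbove ((fun φ => |f φ|) '' B) := by
  obtain ⟨C, hC⟩ := isBounded_iff_forall_norm_le.1
    ((NormedSpace.isVonNBounded_iff ℝ).1 (hB.image f))
  refine ⟨C, ?_⟩
  rintro _ ⟨φ, hφ, rfl⟩
  exact hC _ (mem_image_of_mem _ hφ)

theorem abs_le_dualSeminorm {B : Set E} (hB : Bornology.IsVonNBounded ℝ B) (f : StrongDual ℝ E)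
    {φ : E} (hφ : φ ∈ B) : |f φ| ≤ dualSeminorm B f :=
  le_csSup (bddAbove_abs_image hB f) (mem_image_of_mem _ hφ)

theorem dualSeminorm_nonneg (B : Set E) (f : StrongDual ℝ E) : 0 ≤ dualSeminorm B f := by
  refine Real.sSup_nonneg ?_
  rintro _ ⟨φ, -, rfl⟩
  exact abs_nonneg _

theorem dualSeminorm_le {B : Set E} {f : StrongDual ℝ E} {C : ℝ} (hC : 0 ≤ C)
    (h : ∀ φ ∈ B, |f φ| ≤ C) : dualSeminorm B f ≤ C := by
  refine Real.sSup_le ?_ hC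
  rintro _ ⟨φ, hφ, rfl⟩
  exact h φ hφ

variable [IsTopologicalAddGroup E] [ContinuousSMul ℝ E]

/-- `p_B` as a bundled seminorm. -/
def strongSeminorm {B : Set E} (hB : Bornology.IsVonNBounded ℝ B) :
    Seminorm ℝ (StrongDual ℝ E) :=
  Seminorm.ofSMulLE (dualSeminorm B)
    (le_antisymm (dualSeminorm_le le_rfl (by simp)) (dualSeminorm_nonneg _ _))
    (fun f g => dualSeminorm_le (add_nonneg (dualSeminorm_nonneg _ _) (dualSeminorm_nonneg _ _))
      fun φ hφ => (abs_add_le _ _).trans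
        (add_le_add (abs_le_dualSeminorm hB f hφ) (abs_le_dualSeminorm hB g hφ)))
    (fun r f => dualSeminorm_le (mul_nonneg (norm_nonneg _) (dualSeminorm_nonneg _ _))
      fun φ hφ => by
        rw [smul_apply, smul_eq_mul, abs_mul]
        exact mul_le_mul_of_nonneg_left (abs_le_dualSeminorm hB f hφ) (abs_nonneg _))

theorem continuous_strongSeminorm {B : Set E} (hB : Bornology.IsVonNBounded ℝ B) :
    Continuous (strongSeminorm hB) := by
  refine Seminorm.continuous' (r := 1) ?_
  refine mem_of_superset (ContinuousLinearMap.hasBasis_nhds_zero.mem_of_mem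
    (i := (B, Metric.closedBall (0 : ℝ) 1)) ⟨hB, Metric.closedBall_mem_nhds _ one_pos⟩) ?_
  intro f hf
  rw [Seminorm.mem_closedBall_zero]
  exact dualSeminorm_le zero_le_one fun φ hφ => by
    simpa [Real.dist_eq] using hf φ hφ

/-- Evaluation at `φ` as a continuous functional on the strong dual. -/
def evalDual (φ : E) : StrongDual ℝ E →L[ℝ] ℝ where
  toFun f := f φ
  map_add' _ _ := rfl
  map_smul' _ _ := rfl
  cont := continuous_eval_const φ

theorem countable_jumps_strongDual [TopologicalSpace.SeparableSpace E] {T : ℝ}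
    (x : Cadlag T (StrongDual ℝ E)) : x.jumps.Countable := by
  obtain ⟨D, hD, hDd⟩ := TopologicalSpace.exists_countable_dense E
  have := hD.to_subtype
  refine Cadlag.countable_jumps_of_separating (fun (φ : D) (f : StrongDual ℝ E) => f φ)
    (fun φ => continuous_eval_const (φ : E)) (fun f g h => ?_) x
  exact DFunLike.coe_injective (Continuous.ext_on hDd f.continuous g.continuous
    fun φ hφ => h ⟨φ, hφ⟩)

end DualSeminorm

/-! ### Separability of E and lifting of paths to Hilbert duals -/

section CHNS

variable {E : Type u} [AddCommGroup E] [Module ℝ E]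

theorem norm_toHilbert (c : PreInnerProductSpace.Core ℝ E) (φ : E) :
    ‖toHilbert c φ‖ = hilbertSeminorm c φ :=
  UniformSpace.Completion.norm_coe (E := PreHilbert c) φ

theorem denseRange_toHilbert (c : PreInnerProductSpace.Core ℝ E) : DenseRange (toHilbert c) :=
  UniformSpace.Completion.denseRange_coe (α := PreHilbert c)

theorem hilbertMap_toHilbert {c d : PreInnerProductSpace.Core ℝ E}
    (h : hilbertSeminorm d ≤ hilbertSeminorm c) (φ : E) :
    hilbertMap c d (toHilbert c φ) = toHilbert d φ := by
  let i : PreHilbert c → PreHilbert d := fun φ => φ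
  have hlip : LipschitzWith 1 i := LipschitzWith.mk_one fun φ ψ => by
    rw [dist_eq_norm φ ψ, dist_eq_norm (i φ) (i ψ)]
    exact h (φ - ψ : E)
  exact UniformSpace.Completion.map_coe hlip.uniformContinuous (toPreHilbert c φ)

theorem continuous_hilbertMap (c d : PreInnerProductSpace.Core ℝ E) :
    Continuous (hilbertMap c d) :=
  UniformSpace.Completion.continuous_map

/-- A functional on `E` that is bounded by the seminorm of `c` extends to the completion. -/
theorem exists_strongDual_hilbert (c : PreInnerProductSpace.Core ℝ E) (f : E →ₗ[ℝ] ℝ) {C : ℝ}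
    (h : ∀ φ, |f φ| ≤ C * hilbertSeminorm c φ) :
    ∃ g : StrongDual ℝ (Hilbert c), ∀ φ, g (toHilbert c φ) = f φ := by
  let f' : PreHilbert c →ₗ[ℝ] ℝ := ⟨⟨f, f.map_add⟩, f.map_smul⟩
  let F : PreHilbert c →L[ℝ] ℝ := f'.mkContinuous C h
  refine ⟨F.extend (UniformSpace.Completion.toComplL (𝕜 := ℝ) (E := PreHilbert c)), fun φ => ?_⟩
  exact ContinuousLinearMap.extend_eq F UniformSpace.Completion.denseRange_coe
    (UniformSpace.Completion.isUniformInducing_coe _) (toPreHilbert c φ)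

/-- Parseval's identity for the Riesz representative of `f`. -/
theorem tsum_sq_apply_hilbertBasis {G : Type*} [NormedAddCommGroup G] [InnerProductSpace ℝ G]
    [CompleteSpace G] {ι : Type*} (b : HilbertBasis ι ℝ G) (f : StrongDual ℝ G) :
    ∑' i, f (b i) ^ 2 = ‖f‖ ^ 2 := by
  have h := b.tsum_inner_mul_inner ((InnerProductSpace.toDual ℝ G).symm f)
    ((InnerProductSpace.toDual ℝ G).symm f)
  rw [real_inner_self_eq_norm_sq, LinearIsometryEquiv.norm_map] at h
  rw [← h]
  refine tsum_congr fun i => ?_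
  rw [real_inner_comm ((InnerProductSpace.toDual ℝ G).symm f) (b i),
    InnerProductSpace.toDual_symm_apply, sq]

/-- Pointwise convergence in a ball of `E_{-n}` implies norm convergence in `E_{-m}` if the
injection of `E_m` into `E_n` is Hilbert--Schmidt. -/
theorem tendsto_of_hilbertSchmidt {c d : PreInnerProductSpace.Core ℝ E}
    (hdc : hilbertSeminorm d ≤ hilbertSeminorm c)
    (hs : ∀ s : Set (Hilbert c), Orthonormal ℝ (fun e : s => (e : Hilbert c)) →
      Summable fun e : s => ‖hilbertMap c d e‖ ^ 2)
    {α : Type*} {F : Filter α} {g : α → StrongDual ℝ (Hilbert c)} {g₀ : StrongDual ℝ (Hilbert c)}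
    {C : ℝ} (hC : 0 ≤ C) (hg : ∀ a φ, |g a (toHilbert c φ)| ≤ C * hilbertSeminorm d φ)
    (hg₀ : ∀ φ, |g₀ (toHilbert c φ)| ≤ C * hilbertSeminorm d φ)
    (ht : ∀ φ, Tendsto (fun a => g a (toHilbert c φ)) F (𝓝 (g₀ (toHilbert c φ)))) :
    Tendsto g F (𝓝 g₀) := by
  have hbd : ∀ f : StrongDual ℝ (Hilbert c),
      (∀ φ, |f (toHilbert c φ)| ≤ C * hilbertSeminorm d φ) →
        ∀ v, |f v| ≤ C * ‖hilbertMap c d v‖ := by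
    intro f hf v
    refine (denseRange_toHilbert c).induction_on v (isClosed_le (by fun_prop)
      (continuous_const.mul (continuous_hilbertMap c d).norm)) fun φ => ?_
    rw [hilbertMap_toHilbert hdc, norm_toHilbert]
    exact hf φ
  have hbd' : ∀ f : StrongDual ℝ (Hilbert c),
      (∀ φ, |f (toHilbert c φ)| ≤ C * hilbertSeminorm d φ) → ∀ v, |f v| ≤ C * ‖v‖ := by
    intro f hf v
    refine (denseRange_toHilbert c).induction_on v (isClosed_le (by fun_prop)
      (continuous_const.mul continuous_norm)) fun φ => ?_
    rw [norm_toHilbert]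
    exact (hf φ).trans (mul_le_mul_of_nonneg_left (hdc φ) hC)
  -- Equicontinuity extends the convergence from the dense image of `E` to every vector of the
  -- completion, in particular to an orthonormal basis.
  have heq : Equicontinuous fun a v => g a v :=
    (LipschitzWith.uniformEquicontinuous (fun a v => g a v) C.toNNReal fun a =>
      (g a).lipschitz.weaken (by
        rw [← NNReal.coe_le_coe, Real.coe_toNNReal _ hC]
        exact (g a).opNorm_le_bound hC (hbd' _ (hg a)))).equicontinuous
  have hpt : ∀ v, Tendsto (fun a => g a v) F (𝓝 (g₀ v)) := fun v =>
    (denseRange_toHilbert c).induction_on (p := fun v => Tendsto (fun a => g a v) F (𝓝 (g₀ v))) v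
      (heq.isClosed_setOfPred_tendsto g₀.continuous) ht
  obtain ⟨w, b, hb⟩ := exists_hilbertBasis ℝ (Hilbert c)
  have hsum := hs w (hb ▸ b.orthonormal)
  have hb' : ∀ e : w, b e = e := fun e => congrFun hb e
  -- The squared dual norm is this sum. Its terms are dominated by `(2 * C) ^ 2` times the
  -- Hilbert–Schmidt terms, so dominated convergence applies.
  have hlim : Tendsto (fun a => ∑' e : w, (g a - g₀) (b e) ^ 2) F (𝓝 (∑' _ : w, (0 : ℝ))) := by
    refine tendsto_tsum_of_dominated_convergence (hsum.mul_left ((2 * C) ^ 2)) (fun e => ?_)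
      (Eventually.of_forall fun a e => ?_)
    · have := ((hpt (b e)).sub_const (g₀ (b e))).pow 2
      simpa using this
    · rw [Real.norm_of_nonneg (sq_nonneg _), ← mul_pow, ← sq_abs]
      refine pow_le_pow_left₀ (abs_nonneg _) ?_ 2
      rw [sub_apply, hb']
      have h1 := hbd _ (hg a) e
      have h2 := hbd _ hg₀ e
      have h3 := abs_sub (g a e) (g₀ e)
      linarith
  simp only [tsum_sq_apply_hilbertBasis, tsum_zero] at hlim
  refine (tendsto_iff_norm_sub_tendsto_zero (E := StrongDual ℝ (Hilbert c))).2 ?_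
  have := (Real.continuous_sqrt.tendsto 0).comp hlim
  simpa [Function.comp_def, Real.sqrt_sq] using this

variable [TopologicalSpace E] {c : ℕ → PreInnerProductSpace.Core ℝ E}

theorem IsCHNS.seminorm_le (h : IsCHNS c) {n m : ℕ} (hnm : n ≤ m) (φ : E) :
    hilbertSeminorm (c n) φ ≤ hilbertSeminorm (c m) φ :=
  h.mono hnm φ

theorem IsCHNS.separableSpace (h : IsCHNS c) : TopologicalSpace.SeparableSpace E := by
  have hD : ∀ n, ∃ D : Set E, D.Countable ∧ ∀ φ, ∀ ε > 0, ∃ ψ ∈ D,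
      hilbertSeminorm (c n) (ψ - φ) < ε := by
    intro n
    have := h.separable n
    have := UniformSpace.secondCountable_of_separable (Hilbert (c n))
    have : SecondCountableTopology (PreHilbert (c n)) :=
      (UniformSpace.Completion.isUniformInducing_coe (PreHilbert (c n))).isInducing
        |>.secondCountableTopology
    obtain ⟨D, hD, hDd⟩ := TopologicalSpace.exists_countable_dense (PreHilbert (c n))
    refine ⟨D, hD, fun φ ε hε => ?_⟩
    obtain ⟨ψ, hψ, hψD⟩ := Metric.dense_iff.1 hDd (toPreHilbert (c n) φ) ε hε
    rw [Metric.mem_ball, dist_eq_norm] at hψ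
    exact ⟨ψ, hψD, hψ⟩
  choose D hD hDd using hD
  refine ⟨⋃ n, D n, countable_iUnion hD, fun φ => mem_closure_iff_nhds.2 fun U hU => ?_⟩
  obtain ⟨s, r, hr, hU⟩ := (h.withSeminorms.mem_nhds_iff φ U).1 hU
  obtain ⟨ψ, hψ, hψr⟩ := hDd (s.sup id) φ r hr
  refine ⟨ψ, hU ?_, mem_iUnion.2 ⟨_, hψ⟩⟩
  rw [Seminorm.mem_ball]
  refine lt_of_le_of_lt ?_ hψr
  refine Seminorm.finset_sup_apply_le (apply_nonneg _ _) fun i hi => ?_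
  exact h.seminorm_le (Finset.le_sup (f := id) hi) _

/-- The functionals on `E` with `|f φ| ≤ n ‖φ‖_n`. -/
def dualBall (c : ℕ → PreInnerProductSpace.Core ℝ E) (n : ℕ) : Set (StrongDual ℝ E) :=
  {f | ∀ φ, |f φ| ≤ n * hilbertSeminorm (c n) φ}

variable [IsTopologicalAddGroup E] [ContinuousSMul ℝ E]

theorem isClosed_dualBall (n : ℕ) : IsClosed (dualBall c n) := by
  rw [dualBall, ofPred_forall]
  exact isClosed_iInter fun φ => isClosed_le (continuous_eval_const φ).abs continuous_const

/-- The values of a càdlàg path in the strong dual lie in one of the balls of the spaces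
`E_{-n}`. -/
theorem IsCHNS.exists_forall_mem_dualBall (h : IsCHNS c) {T : ℝ}
    (x : Cadlag T (StrongDual ℝ E)) : ∃ n, ∀ t, x t ∈ dualBall c n := by
  by_contra! hc
  -- Gliding hump: the vectors `ψ n` form a bounded set, since for fixed `m` all but finitely many
  -- have `m`-th seminorm at most `1`. The path would be unbounded for the seminorm of that set.
  have hc' : ∀ n : ℕ, ∃ t, ∃ ψ : E, hilbertSeminorm (c n) ψ ≤ 1 ∧ (n : ℝ) ≤ |x t ψ| := by
    intro n
    obtain ⟨t, ht⟩ := hc n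
    simp only [dualBall, mem_ofPred_eq, not_forall, not_le] at ht
    obtain ⟨φ, hφ⟩ := ht
    have hpos : 0 < |x t φ| := (mul_nonneg n.cast_nonneg (apply_nonneg _ φ)).trans_lt hφ
    refine ⟨t, (n / |x t φ|) • φ, ?_, ?_⟩
    · rw [map_smul_eq_mul, Real.norm_of_nonneg (by positivity), div_mul_eq_mul_div]
      exact div_le_one_of_le₀ hφ.le hpos.le
    · rw [map_smul, smul_eq_mul, abs_mul, abs_div, abs_abs, Nat.abs_cast,
        div_mul_cancel₀ _ hpos.ne']
  choose t ψ hψ1 hψ2 using hc'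
  have hB : Bornology.IsVonNBounded ℝ (range ψ) := by
    rw [h.withSeminorms.isVonNBounded_iff_seminorm_bounded]
    intro m
    refine ⟨2 + ∑ n ∈ Finset.range m, hilbertSeminorm (c m) (ψ n), ?_, ?_⟩
    · have := Finset.sum_nonneg fun n (_ : n ∈ Finset.range m) =>
        apply_nonneg (hilbertSeminorm (c m)) (ψ n)
      linarith
    · rintro _ ⟨n, rfl⟩
      rcases lt_or_ge n m with hnm | hnm
      · have := Finset.single_le_sum (f := fun n => hilbertSeminorm (c m) (ψ n))
          (fun n _ => apply_nonneg (hilbertSeminorm (c m)) (ψ n)) (Finset.mem_range.2 hnm)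
        linarith
      · have := Finset.sum_nonneg fun n (_ : n ∈ Finset.range m) =>
          apply_nonneg (hilbertSeminorm (c m)) (ψ n)
        linarith [h.seminorm_le hnm (ψ n), hψ1 n]
  obtain ⟨C, hC⟩ := x.bddAbove_seminorm (continuous_strongSeminorm hB)
  obtain ⟨n, hn⟩ := exists_nat_gt C
  have h1 : |x (t n) (ψ n)| ≤ C :=
    (abs_le_dualSeminorm hB (x (t n)) (mem_range_self n)).trans (hC (t n))
  linarith [hψ2 n]

theorem Cadlag.left_mem_of_isClosed {T : ℝ} {X : Type u} [AddCommGroup X] [Module ℝ X]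
    [TopologicalSpace X] (x : Cadlag T X) {K : Set X} (hK : IsClosed K) (h : ∀ t, x t ∈ K)
    (t : Icc (0 : ℝ) T) : x.left t ∈ K := by
  rcases eq_or_neBot (𝓝[<] t) with hb | hb
  · rw [Cadlag.left_eq_of_eq_bot _ hb]; exact h t
  · exact hK.mem_of_tendsto (x.tendsto_left t) (Eventually.of_forall h)

/-- A càdlàg path with values in a ball of `E_{-n}` is a càdlàg path in `E_{-m}` if the injection
of `E_m` into `E_n` is Hilbert--Schmidt. -/
theorem IsCHNS.exists_inclPath_eq (h : IsCHNS c) {n m : ℕ} (hnm : n ≤ m)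
    (hs : ∀ s : Set (Hilbert (c m)), Orthonormal ℝ (fun e : s => (e : Hilbert (c m))) →
      Summable fun e : s => ‖hilbertMap (c m) (c n) e‖ ^ 2) {T : ℝ}
    (x : Cadlag T (StrongDual ℝ E)) (hx : ∀ t, x t ∈ dualBall c n) :
    ∃ y, inclPath h m y = x := by
  have hlift : ∀ f ∈ dualBall c n, ∃ g : StrongDual ℝ (Hilbert (c m)),
      ∀ φ, g (toHilbert (c m) φ) = f φ := fun f hf =>
    exists_strongDual_hilbert (c m) f.toLinearMap (C := n) fun φ =>
      (hf φ).trans (mul_le_mul_of_nonneg_left (h.seminorm_le hnm φ) n.cast_nonneg)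
  choose! L hL using hlift
  have key : ∀ (F : Filter (Icc (0 : ℝ) T)) (f : StrongDual ℝ E), f ∈ dualBall c n →
      Tendsto x F (𝓝 f) → Tendsto (fun t => L (x t)) F (𝓝 (L f)) := by
    intro F f hf ht
    refine tendsto_of_hilbertSchmidt (h.mono hnm) hs n.cast_nonneg (fun t φ => ?_) (fun φ => ?_)
      fun φ => ?_
    · rw [hL _ (hx t)]; exact hx t φ
    · rw [hL _ hf]; exact hf φ
    · simp only [hL _ (hx _), hL _ hf]
      exact ((continuous_eval_const φ).tendsto f).comp ht
  -- The left limits of `x` lie in the same ball, which is closed, so they can be lifted too.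
  refine ⟨⟨fun t => L (x t), fun t => key _ _ (hx t) (x.right_continuous t), fun t => ⟨_, key _ _
    (x.left_mem_of_isClosed (isClosed_dualBall n) hx t) (x.tendsto_left t)⟩⟩, ?_⟩
  have : ∀ t, (h.dualIncl m) (L (x t)) = x t := fun t =>
    ContinuousLinearMap.ext fun φ => hL _ (hx t) φ
  show (⟨_, _, _⟩ : Cadlag T (StrongDual ℝ E)) = x
  cases x
  simp only [Cadlag.mk.injEq]
  exact funext this

end CHNS

/-! ### Borel sets and the Kolmogorov σ-algebra -/

/-! ### Weak measurability in duals of separable Hilbert spaces -/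

section HilbertDual

variable {G : Type u} [NormedAddCommGroup G] [InnerProductSpace ℝ G] [CompleteSpace G]
  [TopologicalSpace.SeparableSpace G]

theorem secondCountableTopology_strongDual : SecondCountableTopology (StrongDual ℝ G) := by
  have := UniformSpace.secondCountable_of_separable G
  exact (InnerProductSpace.toDual ℝ G).symm.toHomeomorph.secondCountableTopology

/-- A map into the dual of a separable Hilbert space is measurable if it is so weakly, on a dense
sequence of vectors. -/
theorem measurable_strongDual_of_dense {Ω : Type*} [MeasurableSpace Ω]
    [MeasurableSpace (StrongDual ℝ G)] [BorelSpace (StrongDual ℝ G)] {D : Set G} (hD : D.Countable)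
    (hDd : Dense D) {g : Ω → StrongDual ℝ G} (hg : ∀ v ∈ D, Measurable fun ω => g ω v) :
    Measurable g := by
  have := secondCountableTopology_strongDual (G := G)
  have hbasis : TopologicalSpace.IsTopologicalBasis
      {U | ∃ (f : StrongDual ℝ G) (r : ℝ), U = Metric.ball f r} := by
    refine TopologicalSpace.isTopologicalBasis_of_isOpen_of_nhds ?_ fun f U hf hU => ?_
    · rintro _ ⟨f, r, rfl⟩
      exact Metric.isOpen_ball
    · obtain ⟨r, hr, h⟩ := Metric.isOpen_iff.1 hU f hf
      exact ⟨_, ⟨f, r, rfl⟩, Metric.mem_ball_self hr, h⟩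
  rw [BorelSpace.measurable_eq (α := StrongDual ℝ G), hbasis.borel_eq_generateFrom]
  refine measurable_generateFrom ?_
  rintro _ ⟨f, r, rfl⟩
  -- An operator norm is below `r` iff some rational `q < r` is a bound, and a bound need only be
  -- tested on a dense set.
  have hset : g ⁻¹' Metric.ball f r = ⋃ (q : ℚ) (_ : 0 ≤ (q : ℝ) ∧ (q : ℝ) < r),
      ⋂ v ∈ D, {ω | |g ω v - f v| ≤ q * ‖v‖} := by
    ext ω
    simp only [mem_preimage, mem_iUnion, mem_iInter, exists_prop, mem_ofPred_eq]
    rw [Metric.mem_ball, dist_eq_norm (g ω) f]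
    constructor
    · intro h
      obtain ⟨q, hq, hqr⟩ := exists_rat_btwn h
      exact ⟨q, ⟨(norm_nonneg _).trans hq.le, hqr⟩, fun v _ => ((g ω - f).le_opNorm v).trans
        (mul_le_mul_of_nonneg_right hq.le (norm_nonneg v))⟩
    · rintro ⟨q, ⟨hq0, hqr⟩, h⟩
      refine lt_of_le_of_lt ((g ω - f).opNorm_le_bound hq0 fun v => ?_) hqr
      have hcl : IsClosed {v | ‖(g ω - f) v‖ ≤ q * ‖v‖} :=
        isClosed_le (g ω - f).continuous.norm (continuous_const.mul continuous_norm)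
      exact closure_minimal (s := D) h hcl (hDd v)
  rw [hset]
  exact MeasurableSet.iUnion fun q => MeasurableSet.iUnion fun _ =>
    MeasurableSet.biInter hD fun v hv => measurableSet_le
      (continuous_abs.measurable.comp ((hg v hv).sub_const _)) measurable_const

end HilbertDual

/-! ### Measurability of maps into path spaces of normed spaces -/

namespace Cadlag

variable {T : ℝ} {H : Type u} [NormedAddCommGroup H] [NormedSpace ℝ H]

theorem continuous_normSeminorm : Continuous (normSeminorm ℝ H) := continuous_norm

theorem m1_eq (hT : 0 < T) (hH : ∀ x : Cadlag T H, x.jumps.Countable) :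
    m1 T H = (m1PseudoMetric hT hH continuous_normSeminorm).toUniformSpace.toTopologicalSpace :=
  m1Of_singleton hT hH continuous_normSeminorm

/-- Only the finitely many coordinates in `[0, ⌊N * T⌋]` matter, so the product topology suffices.
-/
theorem continuous_step (hT : 0 < T) (hH : ∀ x : Cadlag T H, x.jumps.Countable) {N : ℝ}
    (hN : 0 < N) : Continuous[_, m1 T H] fun v : ℤ → H => step T hN v := by
  rw [m1_eq hT hH]
  let _ := m1PseudoMetric hT hH continuous_normSeminorm
  refine continuous_iff_continuousAt.2 fun v => Metric.tendsto_nhds.2 fun ε hε => ?_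
  have hev : ∀ᶠ w in 𝓝 v, ∀ i ∈ Icc (0 : ℤ) ⌊N * T⌋, ‖w i - v i‖ < ε / 2 := by
    refine (eventually_all_finite (finite_Icc _ _)).2 fun i _ => ?_
    have : Continuous fun w : ℤ → H => ‖w i - v i‖ := by fun_prop
    exact this.continuousAt.eventually (gt_mem_nhds (by simpa using half_pos hε))
  filter_upwards [hev] with w hw
  exact (m1Dist_step_le hT hH continuous_normSeminorm hN (half_pos hε).le
    fun i hi => (hw i hi).le).trans_lt (half_lt_self hε)

/-- A map into `D_H` is Borel measurable for the M1 topology if all evaluations are. -/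
theorem measurable_m1_of_apply (hT : 0 < T) (hH : ∀ x : Cadlag T H, x.jumps.Countable)
    [SecondCountableTopology H] {Ω : Type*} [MeasurableSpace Ω] [MeasurableSpace H] [BorelSpace H]
    {f : Ω → Cadlag T H} (hf : ∀ t, Measurable fun ω => f ω t) :
    @Measurable _ _ _ (@borel (Cadlag T H) (m1 T H)) f := by
  have hstep := fun {N : ℝ} (hN : 0 < N) => continuous_step hT hH hN
  rw [m1_eq hT hH] at hstep ⊢
  let _ := m1PseudoMetric hT hH continuous_normSeminorm
  let _ : MeasurableSpace (Cadlag T H) := borel _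
  have : BorelSpace (Cadlag T H) := ⟨rfl⟩
  have hN : ∀ k : ℕ, 0 < ((k : ℝ) + 1) / T := fun k => by positivity
  -- Each discretization is a continuous function of countably many evaluations, and the
  -- discretizations converge pointwise to `f`.
  refine measurable_of_tendsto_metrizable' (f := fun (k : ℕ) ω => (f ω).discretize hT.le (hN k))
    atTop (fun k => ?_) (tendsto_pi_nhds.2 fun ω => Metric.tendsto_nhds.2 fun ε hε => ?_)
  · exact (hstep (hN k)).measurable.comp
      (measurable_pi_lambda (fun ω (i : ℤ) => f ω (projIcc 0 T hT.le (i / (((k : ℝ) + 1) / T))))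
        fun i => hf _)
  · filter_upwards [eventually_m1Dist_discretize_le hT hH continuous_normSeminorm (f ω)
      (half_pos hε)] with k hk
    rw [dist_comm]
    exact lt_of_le_of_lt hk (half_lt_self hε)

end Cadlag

/-! ### The assertions about paths in the strong dual -/

section CHNS

variable {E : Type u} [AddCommGroup E] [Module ℝ E] [TopologicalSpace E] {T : ℝ}

theorem measurable_kolmogorov_apply (t : Icc (0 : ℝ) T) (φ : E) :
    @Measurable _ _ (kolmogorov E T) _ fun x : Cadlag T (StrongDual ℝ E) => x t φ := by
  let _ : MeasurableSpace (Cadlag T (StrongDual ℝ E)) := kolmogorov E T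
  have h : Measurable fun (x : Cadlag T (StrongDual ℝ E)) (_ : Fin 1) => x t φ :=
    measurable_iff_comap_le.2 (le_iSup_of_le 1 (le_iSup_of_le (fun _ => t)
      (le_iSup_of_le (fun _ => φ) le_rfl)))
  exact (measurable_pi_apply (0 : Fin 1)).comp h

variable [IsTopologicalAddGroup E] [ContinuousSMul ℝ E]
  {c : ℕ → PreInnerProductSpace.Core ℝ E}

theorem continuous_evalPath (h : IsCHNS c) (hT : 0 < T) (φ : E) :
    Continuous[dualM1 E T, Cadlag.m1 T ℝ] (evalPath φ) := by
  have := h.separableSpace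
  refine Cadlag.continuous_map_m1Of hT countable_jumps_strongDual Cadlag.countable_jumps_real
    (evalDual φ) ?_
  rintro _ rfl
  have hB : Bornology.IsVonNBounded ℝ ({φ} : Set E) := Bornology.isVonNBounded_singleton φ
  refine ⟨normSeminorm ℝ ℝ, continuous_norm, rfl, strongSeminorm hB, continuous_strongSeminorm hB,
    ⟨_, hB, rfl⟩, 1, fun f => ?_⟩
  rw [one_mul]
  exact abs_le_dualSeminorm hB f rfl

theorem continuous_inclPath (h : IsCHNS c) (hT : 0 < T) (n : ℕ) :
    Continuous[Cadlag.m1 T (StrongDual ℝ (Hilbert (c n))), dualM1 E T] (inclPath h n) := by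
  have := h.separableSpace
  have := h.separable n
  refine Cadlag.continuous_map_m1Of hT countable_jumps_strongDual countable_jumps_strongDual
    (h.dualIncl n) ?_
  rintro _ ⟨B, hB, rfl⟩
  obtain ⟨C, hC⟩ := isBounded_iff_forall_norm_le.1
    ((NormedSpace.isVonNBounded_iff ℝ).1 (hB.image (h.toHilbertL n)))
  refine ⟨strongSeminorm hB, continuous_strongSeminorm hB, rfl,
    normSeminorm ℝ (StrongDual ℝ (Hilbert (c n))),
    continuous_norm (E := StrongDual ℝ (Hilbert (c n))), mem_singleton _,
    max C 0, fun f => ?_⟩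
  refine dualSeminorm_le (mul_nonneg (le_max_right _ _) (apply_nonneg _ f)) fun φ hφ => ?_
  have h1 : |f (h.toHilbertL n φ)| ≤ ‖f‖ * ‖h.toHilbertL n φ‖ := f.le_opNorm _
  refine h1.trans ?_
  rw [mul_comm]
  exact mul_le_mul_of_nonneg_right ((hC _ (mem_image_of_mem _ hφ)).trans (le_max_left _ _))
    (norm_nonneg f)

theorem exists_seminorm_of_mem_strong {p : StrongDual ℝ E → ℝ}
    (hp : p ∈ {p | ∃ B : Set E, Bornology.IsVonNBounded ℝ B ∧ p = dualSeminorm B}) :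
    ∃ q : Seminorm ℝ (StrongDual ℝ E), Continuous q ∧ p = q := by
  obtain ⟨B, hB, rfl⟩ := hp
  exact ⟨strongSeminorm hB, continuous_strongSeminorm hB, rfl⟩

theorem t35Space_dualM1 (h : IsCHNS c) (hT : 0 < T) :
    @T35Space (Cadlag T (StrongDual ℝ E)) (dualM1 E T) := by
  have := h.separableSpace
  let _ := dualM1 E T
  have hX : ∀ x : Cadlag T (StrongDual ℝ E), x.jumps.Countable := countable_jumps_strongDual
  have : CompletelyRegularSpace (Cadlag T (StrongDual ℝ E)) :=
    Cadlag.completelyRegularSpace_m1Of hT hX fun _ => exists_seminorm_of_mem_strong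
  have : T0Space (Cadlag T (StrongDual ℝ E)) := by
    refine ⟨fun x y hxy => ?_⟩
    have hpt : ∀ t, x t = y t := by
      refine fun t => ContinuousLinearMap.ext fun φ => ?_
      have hB : Bornology.IsVonNBounded ℝ ({φ} : Set E) := Bornology.isVonNBounded_singleton φ
      have hd : Cadlag.m1Dist (strongSeminorm hB) x y = 0 := by
        refine le_antisymm (le_of_forall_pos_le_add fun ε hε => ?_) (Cadlag.m1Dist_nonneg _ x y)
        have hU := Cadlag.isOpen_m1Of_ball (T := T)
          (P := {p | ∃ B : Set E, Bornology.IsVonNBounded ℝ B ∧ p = dualSeminorm B})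
          (p := strongSeminorm hB) ⟨_, hB, rfl⟩ y hε
        have hy : Cadlag.m1Dist (strongSeminorm hB) y y < ε := by
          rwa [Cadlag.m1Dist_self _ hT hX]
        rw [zero_add]
        exact le_of_lt ((hxy.mem_open_iff hU).2 hy)
      have h0 := Cadlag.seminorm_sub_eq_zero_of_m1Dist hT hX (continuous_strongSeminorm hB) hd t
      have h1 : |(x t - y t) φ| ≤ 0 := h0 ▸ abs_le_dualSeminorm hB (x t - y t) rfl
      exact sub_eq_zero.1 (abs_nonpos_iff.1 h1)
    cases x
    cases y
    simp only [Cadlag.mk.injEq]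
    exact funext hpt
  exact {}

theorem kolmogorov_le_borel (h : IsCHNS c) (hT : 0 < T) :
    kolmogorov E T ≤ @borel (Cadlag T (StrongDual ℝ E)) (dualM1 E T) := by
  refine iSup_le fun k => iSup_le fun t => iSup_le fun φ => ?_
  let _ : MeasurableSpace (Cadlag T (StrongDual ℝ E)) :=
    @borel (Cadlag T (StrongDual ℝ E)) (dualM1 E T)
  refine measurable_iff_comap_le.1 (measurable_pi_lambda _ fun i => ?_)
  let _ := dualM1 E T
  let _ := Cadlag.m1 T ℝ
  let _ : MeasurableSpace (Cadlag T ℝ) := borel _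
  have : BorelSpace (Cadlag T (StrongDual ℝ E)) := ⟨rfl⟩
  have : BorelSpace (Cadlag T ℝ) := ⟨rfl⟩
  exact (Cadlag.measurable_apply_m1_real hT (t i)).comp
    (continuous_evalPath h hT (φ i)).measurable

/-- Closedness of the ball and right-continuity reduce the condition to a countable dense set of
times, with `T` added by hand, and to a countable dense set of vectors. -/
theorem measurableSet_forall_mem_dualBall (h : IsCHNS c) (hT : 0 < T) (n : ℕ) :
    @MeasurableSet _ (kolmogorov E T)
      {x : Cadlag T (StrongDual ℝ E) | ∀ t, x t ∈ dualBall c n} := by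
  have := h.separableSpace
  let _ : MeasurableSpace (Cadlag T (StrongDual ℝ E)) := kolmogorov E T
  obtain ⟨D, hD, hDd⟩ := TopologicalSpace.exists_countable_dense E
  obtain ⟨Q, hQ, hQd⟩ := TopologicalSpace.exists_countable_dense (Icc (0 : ℝ) T)
  set e : Icc (0 : ℝ) T := ⟨T, right_mem_Icc.2 hT.le⟩ with he
  have hset : {x : Cadlag T (StrongDual ℝ E) | ∀ t, x t ∈ dualBall c n} =
      ⋂ t ∈ insert e Q, ⋂ φ ∈ D, {x | |x t φ| ≤ n * hilbertSeminorm (c n) φ} := by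
    ext x
    simp only [mem_iInter, mem_ofPred_eq]
    refine ⟨fun hx t _ φ _ => hx t φ, fun hx => ?_⟩
    have h1 : ∀ t ∈ insert e Q, x t ∈ dualBall c n := fun t ht φ =>
      closure_minimal (s := D) (hx t ht) (isClosed_le (x t).continuous.abs
        (continuous_const.mul (h.withSeminorms.continuous_seminorm n))) (hDd φ)
    intro t
    rcases (show t ≤ e from t.2.2).eq_or_lt with ht | ht
    · exact h1 t (ht ▸ mem_insert _ _)
    · have hf := Cadlag.frequently_nhdsGT_of_dense hQd ht
      exact (isClosed_dualBall n).mem_of_frequently_of_tendsto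
        (hf.mono fun v hv => h1 v (mem_insert_of_mem _ hv)) (x.tendsto_right t)
  rw [hset]
  exact MeasurableSet.biInter (hQ.insert e) fun t _ => MeasurableSet.biInter hD fun φ _ =>
    measurableSet_le (continuous_abs.measurable.comp (measurable_kolmogorov_apply t φ))
      measurable_const

theorem borel_le_kolmogorov (h : IsCHNS c) (hT : 0 < T) :
    @borel (Cadlag T (StrongDual ℝ E)) (dualM1 E T) ≤ kolmogorov E T := by
  have := h.separableSpace
  let mK : MeasurableSpace (Cadlag T (StrongDual ℝ E)) := kolmogorov E T
  refine MeasurableSpace.generateFrom_le fun U hU => ?_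
  let A : ℕ → Set (Cadlag T (StrongDual ℝ E)) := fun n => {x | ∀ t, x t ∈ dualBall c n}
  have hA : ∀ n, MeasurableSet (A n) := measurableSet_forall_mem_dualBall h hT
  suffices hUA : ∀ n, MeasurableSet (U ∩ A n) by
    have : U = ⋃ n, U ∩ A n := by
      rw [← inter_iUnion, eq_comm, inter_eq_left]
      exact fun x _ => mem_iUnion.2 (h.exists_forall_mem_dualBall x)
    rw [this]
    exact MeasurableSet.iUnion hUA
  intro n
  obtain ⟨m, hnm, hs⟩ := h.hilbertSchmidt n
  have := h.separable m
  have hlift : ∀ x : A n, ∃ y, inclPath h m y = (x : Cadlag T (StrongDual ℝ E)) := fun x => 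
    h.exists_inclPath_eq hnm.le hs x.1 x.2
  choose J hJ using hlift
  let _ : MeasurableSpace (StrongDual ℝ (Hilbert (c m))) := borel _
  have : BorelSpace (StrongDual ℝ (Hilbert (c m))) := ⟨rfl⟩
  have := secondCountableTopology_strongDual (G := Hilbert (c m))
  obtain ⟨D, hD, hDd⟩ := TopologicalSpace.exists_countable_dense E
  have hDd' : Dense (toHilbert (c m) '' D) :=
    (denseRange_toHilbert (c m)).dense_image (h.toHilbertL m).continuous hDd
  -- On the image of `E`, the evaluations of the lift are those of the original path, hence
  -- Kolmogorov measurable.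
  have hJm : @Measurable _ _ _ (@borel _ (Cadlag.m1 T (StrongDual ℝ (Hilbert (c m))))) J := by
    refine Cadlag.measurable_m1_of_apply hT countable_jumps_strongDual fun t => ?_
    refine measurable_strongDual_of_dense (hD.image _) hDd' ?_
    rintro _ ⟨φ, -, rfl⟩
    have he : (fun x : A n => J x t (toHilbert (c m) φ)) =
        fun x : A n => (x : Cadlag T (StrongDual ℝ E)) t φ := by
      funext x
      exact congrArg (fun y : Cadlag T (StrongDual ℝ E) => y t φ) (hJ x)
    rw [he]
    exact (measurable_kolmogorov_apply t φ).comp measurable_subtype_coe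
  have hV := (continuous_def.1 (continuous_inclPath h hT m)) U hU
  -- `J` is a section of the inclusion over `A n`, and the inner preimage of `U` is M1-open.
  have himage : U ∩ A n = Subtype.val '' (J ⁻¹' (inclPath h m ⁻¹' U)) := by
    ext x
    constructor
    · rintro ⟨hxU, hxA⟩
      refine ⟨⟨x, hxA⟩, ?_, rfl⟩
      rw [mem_preimage, mem_preimage, hJ]
      exact hxU
    · rintro ⟨y, hy, rfl⟩
      rw [mem_preimage, mem_preimage, hJ] at hy
      exact ⟨hy, y.2⟩
  rw [himage]
  exact (hA n).subtype_image (hJm (MeasurableSpace.measurableSet_generateFrom hV))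

end CHNS

end SkorokhodM1

end

open SkorokhodM1 in
theorem proposition2p6 {E : Type*} [AddCommGroup E] [Module ℝ E] [TopologicalSpace E]
    [IsTopologicalAddGroup E] [ContinuousSMul ℝ E]
    (c : ℕ → PreInnerProductSpace.Core ℝ E) (hE : IsCHNS c) (T : ℝ) (hT : 0 < T) :
    (∀ φ : E, Continuous[dualM1 E T, Cadlag.m1 T ℝ] (evalPath φ)) ∧
    (∀ n : ℕ, Continuous[Cadlag.m1 T (StrongDual ℝ (Hilbert (c n))), dualM1 E T]
      (inclPath hE n)) ∧
    @T35Space (Cadlag T (StrongDual ℝ E)) (dualM1 E T) ∧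
    @borel (Cadlag T (StrongDual ℝ E)) (dualM1 E T) = kolmogorov E T :=
  ⟨continuous_evalPath hE hT, continuous_inclPath hE hT, t35Space_dualM1 hE hT,
    le_antisymm (borel_le_kolmogorov hE hT) (kolmogorov_le_borel hE hT)⟩
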